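/- Let $f(z)=\lambda e^z$, $\lambda\in\mathbb C\setminus\{0\}$, have an attracting periodic cycle of exact period $p>1$. Label it $z_0,\dots,z_p=z_0$ with $z_{j+1}=f(z_j)$, and let $U_j$ be the component of its basin of attraction containing $z_j$, the labelling being such that $0\in U_1$. Let $B\subset U_1$ be a simply connected domain with $0,z_1\in B$, whose boundary is a Jordan curve in $U_1$, and with $\overline{f^p(B)}\subset B$. Let $C_p\subset f^{-1}(B)$ be a domain containing $z_0$ and some left half-plane, such that $\partial C_p$ is a curve homeomorphic to the real line whose two ends have imaginary parts tending to $+\infty$ and $-\infty$, $\partial C_p$ coincides with $\partial f^{-1}(B)$ on $\{|\operatorname{Im} z|<L_1\}$ and is vertical on each of $\{\operatorname{Im} z>L_2\}$ and $\{\operatorname{Im} z<-L_2\}$ for some constants $L_1,L_2>0$. For $j=p-1,\dots,1$ let $C_j$ be the component of $f^{-1}(C_{j+1})$ containing $z_j$, and let $C_0=f^{-1}(C_1)$; the choice of $C_p$ is such that $\overline B\subset C_1$ (this holds if $L_1$ is chosen sufficiently large). Let $\mathcal H_0$ be any component of $\mathbb C\setminus C_0$, put $\mathcal H_s=\mathcal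 H_0+2\pi i s$ for $s\in\mathbb Z$, and let $k_1,\dots,k_{p-1}\in\mathbb Z$ be given by $z_j\in\mathcal H_{k_j}$. A point $z$ has itinerary $(t_0,t_1,\dots)\in\mathbb Z^{\mathbb N}$ if $f^n(z)\in\mathcal H_{t_n}$ for all $n\ge 0$. Let $\Sigma'_{\underline k}$ be the set of all sequences $$(s_0,k_1,\dots,k_{p-1},s_1,k_1,\dots,k_{p-1},s_2,\dots),\qquad s_n\in\mathbb Z,$$ such that $s_n\notin\{k_1,\dots,k_{p-1}\}$ for infinitely many $n$, and let $$A=\{z\in J(f): z\text{ has itinerary in }\Sigma'_{\underline k}\text{ and the forward orbit of }z\text{ under }f\text{ is bounded}\},$$ where $J(f)$ is the Julia set of $f$ (the complement of the set of normality of the iterates). Then the hyperbolic dimension of $A$ is greater than $1$, that is, the supremum of $\dim_H X$ over all compact sets $X\subset A$ with $f^p(X)=X$ on which $f^p$ is expanding (there are $c>0$, $\kappa>1$ with $|(f^{pn})'|\ge c\kappa^n$ on $X$ for all $n\ge 0$) is greater than $1$. Moreover, $A$ contains a Cantor set $X$ (non-empty, compact, perfect and totally disconnected) with $f^p(X)=X$,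 $|(f^p)'|>1$ on $X$ and $\dim_H X>1$. -/

import Mathlib

open Set Filter Topology Function

noncomputable section

namespace ExpBasin

/-- The exponential map `z ↦ lam * exp z`. -/
def expMap (lam : ℂ) : ℂ → ℂ := fun z => lam * Complex.exp z

/-! ### Fatou and Julia sets -/

/-- The iterates of `f` form a normal family on `U` (for `U` open and connected and `f` entire):
every sequence of iterates has a subsequence which converges locally uniformly on `U`, either to
a finite function or to `∞`. -/
def IteratesNormalOn (f : ℂ → ℂ) (U : Set ℂ) : Prop :=
  ∀ m : ℕ → ℕ, ∃ φ : ℕ → ℕ, StrictMono φ ∧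
    ((∃ g : ℂ → ℂ, TendstoLocallyUniformlyOn (fun i => f^[m (φ i)]) g atTop U) ∨
      (∀ K : Set ℂ, K ⊆ U → IsCompact K → ∀ M : ℝ,
        ∀ᶠ i in atTop, ∀ z ∈ K, M < ‖f^[m (φ i)] z‖))

/-- The Fatou set of an entire function. -/
def fatouSet (f : ℂ → ℂ) : Set ℂ :=
  {z | ∃ U : Set ℂ, IsOpen U ∧ IsConnected U ∧ z ∈ U ∧ IteratesNormalOn f U}

/-- The Julia set of an entire function. -/
def juliaSet (f : ℂ → ℂ) : Set ℂ := (fatouSet f)ᶜ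

/-! ### Attracting cycles and their basins -/

/-- `z₀` lies on an attracting periodic cycle of `f` of (exact) period `p`. -/
structure IsAttractingCycle (f : ℂ → ℂ) (p : ℕ) (z₀ : ℂ) : Prop where
  pos : 0 < p
  minimalPeriod_eq : minimalPeriod f z₀ = p
  multiplier_lt : ‖deriv (f^[p]) z₀‖ < 1

/-- The entire basin of attraction of the cycle `z₀, f z₀, …` of period `p`. -/
def basin (f : ℂ → ℂ) (p : ℕ) (z₀ : ℂ) : Set ℂ :=
  {z | ∃ j : ℕ, Tendsto (fun n : ℕ => f^[n * p] z) atTop (𝓝 (f^[j] z₀))}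

/-- `U_j`: the component of the basin which contains the point `z_j = f^j(z₀)` of the cycle. -/
def basinComp (f : ℂ → ℂ) (p : ℕ) (z₀ : ℂ) (j : ℕ) : Set ℂ :=
  connectedComponentIn (basin f p z₀) (f^[j] z₀)

/-! ### The sets `C_j` and `H_s` -/

/-- Successive pull-backs of `C` along the cycle: `pullBack f p z₀ C i` is the set `C_{p - i}`,
where `C_p = C` and `C_j` is the component of `f⁻¹(C_{j+1})` containing `z_j = f^j(z₀)`.
Only the indices `i < p` are used. -/
def pullBack (f : ℂ → ℂ) (p : ℕ) (z₀ : ℂ) (C : Set ℂ) : ℕ → Set ℂ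
  | 0 => C
  | i + 1 => connectedComponentIn (f ⁻¹' pullBack f p z₀ C i) (f^[p - (i + 1)] z₀)

/-- The set `C_1` obtained from `C_p = C`. -/
def domC1 (f : ℂ → ℂ) (p : ℕ) (z₀ : ℂ) (C : Set ℂ) : Set ℂ := pullBack f p z₀ C (p - 1)

/-- The set `C_0 = f⁻¹(C_1)` obtained from `C_p = C`. -/
def domC0 (f : ℂ → ℂ) (p : ℕ) (z₀ : ℂ) (C : Set ℂ) : Set ℂ := f ⁻¹' domC1 f p z₀ C

/-- The choices made in the construction of the symbolic dynamics:
`B` is the set `B_{p+1}` and `C` is the set `C_p ⊆ B_p = f⁻¹(B_{p+1})`. -/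
structure IsBasinConstruction (f : ℂ → ℂ) (p : ℕ) (z₀ : ℂ) (B C : Set ℂ) : Prop where
  /-- `B` is a simply connected domain in `U_1` containing `0` and `z_1`. -/
  isOpen_B : IsOpen B
  simplyConnected_B : IsSimplyConnected B
  B_subset : B ⊆ basinComp f p z₀ 1
  zero_mem_B : (0 : ℂ) ∈ B
  z1_mem_B : f z₀ ∈ B
  /-- The boundary of `B` is a Jordan curve in `U_1`. -/
  jordan_B : ∃ γ : Circle → ℂ, Continuous γ ∧ Injective γ ∧ range γ = frontier B
  frontier_B_subset : frontier B ⊆ basinComp f p z₀ 1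
  closure_image_subset : closure (f^[p] '' B) ⊆ B
  /-- `C` is a domain in `f⁻¹(B)` containing `z_0` and some left half-plane. -/
  isOpen_C : IsOpen C
  isConnected_C : IsConnected C
  C_subset : C ⊆ f ⁻¹' B
  z0_mem_C : z₀ ∈ C
  leftHalfPlane_C : ∃ c : ℝ, {z : ℂ | z.re < c} ⊆ C
  /-- The boundary of `C` is a curve homeomorphic to the real line, and the imaginary parts of
  its two ends tend to `±∞`. -/
  frontier_C : ∃ γ : ℝ → ℂ, IsEmbedding γ ∧ range γ = frontier C ∧
    Tendsto (fun t => (γ t).im) atTop atTop ∧ Tendsto (fun t => (γ t).im) atBot atBot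
  /-- The boundary of `C` coincides with that of `f⁻¹(B)` near the real axis. -/
  frontier_C_eq : ∃ L₁ : ℝ, 0 < L₁ ∧
    frontier C ∩ {z : ℂ | |z.im| < L₁} = frontier (f ⁻¹' B) ∩ {z : ℂ | |z.im| < L₁}
  /-- The boundary of `C` is vertical far from the real axis. -/
  frontier_C_vertical : ∃ L₂ : ℝ, 0 < L₂ ∧ ∃ a b : ℝ,
    frontier C ∩ {z : ℂ | L₂ < z.im} = {z : ℂ | z.re = a ∧ L₂ < z.im} ∧
    frontier C ∩ {z : ℂ | z.im < -L₂} = {z : ℂ | z.re = b ∧ z.im < -L₂}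
  /-- The size condition on the choice of `C`. -/
  closure_B_subset : closure B ⊆ domC1 f p z₀ C

/-- `H_s = H_0 + 2πis`, where `H_0` is the component of `ℂ ∖ C_0` which contains `w`. -/
def strip (f : ℂ → ℂ) (p : ℕ) (z₀ : ℂ) (C : Set ℂ) (w : ℂ) (s : ℤ) : Set ℂ :=
  (fun z : ℂ => z + 2 * Real.pi * Complex.I * s) '' connectedComponentIn (domC0 f p z₀ C)ᶜ w

/-! ### Itineraries -/

/-- The sequence `t` is an itinerary of `z` with respect to the sets `H s`. -/
def HasItinerary (f : ℂ → ℂ) (H : ℤ → Set ℂ) (z : ℂ) (t : ℕ → ℤ) : Prop :=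
  ∀ n : ℕ, f^[n] z ∈ H (t n)

/-- The set `Σ'_k` of the sequences `(s_0, k_1, …, k_{p-1}, s_1, k_1, …, k_{p-1}, s_2, …)` with
`s_n ∉ {k_1, …, k_{p-1}}` for infinitely many `n`. -/
def sigmaPrime (p : ℕ) (k : ℕ → ℤ) : Set (ℕ → ℤ) :=
  {t | (∀ n j : ℕ, 1 ≤ j → j < p → t (n * p + j) = k j) ∧
    {n : ℕ | ∀ j : ℕ, 1 ≤ j → j < p → t (n * p) ≠ k j}.Infinite}

/-- The set of all `z ∈ J(f)` with itinerary in `Σ'_k` and with bounded forward orbit. -/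
def boundedItinerarySet (f : ℂ → ℂ) (p : ℕ) (H : ℤ → Set ℂ) (k : ℕ → ℤ) : Set ℂ :=
  {z | z ∈ juliaSet f ∧ (∃ t ∈ sigmaPrime p k, HasItinerary f H z t) ∧
    Bornology.IsBounded (range fun n : ℕ => f^[n] z)}

/-! ### Hyperbolic dimension -/

/-- `X` is a hyperbolic set for `g`: a compact invariant set on which `g` is expanding. -/
structure IsHyperbolicSet (g : ℂ → ℂ) (X : Set ℂ) : Prop where
  isCompact : IsCompact X
  invariant : g '' X = X
  expanding : ∃ c > (0 : ℝ), ∃ κ > (1 : ℝ), ∀ n : ℕ, ∀ z ∈ X, c * κ ^ n ≤ ‖deriv (g^[n]) z‖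

/-- The hyperbolic dimension of `A` with respect to the dynamics of `g`: the supremum of the
Hausdorff dimensions of the hyperbolic sets of `g` contained in `A`. -/
def hyperbolicDim (g : ℂ → ℂ) (A : Set ℂ) : ENNReal :=
  ⨆ (X : Set ℂ) (_ : X ⊆ A) (_ : IsHyperbolicSet g X), dimH X

/-- A Cantor set in the plane: non-empty, compact, perfect and totally disconnected. -/
structure IsCantorSet (X : Set ℂ) : Prop where
  nonempty : X.Nonempty
  isCompact : IsCompact X
  perfect : Perfect X
  isTotallyDisconnected : IsTotallyDisconnected X

end ExpBasin

end

open Set Filter Topology Function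

noncomputable section

namespace ExpBasin

/-! ### Elementary facts on the exponential map -/

/-! Far from the origin, `f^p` has inverse branches z ↦ log ⋯ log z + 2πis, where the logarithm is
taken p times and a constant is added at each level. At a point of modulus x the derivative is of
order at least 1/(x log x ⋯ log^{p-1} x), up to the additive constants. For s = N + i with i < m the
image points have modulus at most 8(N + i). The sum of the corresponding ratios `c i` over i
diverges, because the p-fold iterated logarithm is an antiderivative tending to infinity. Finitely
many branches therefore suffice for ∑ `c i` > 1, hence ∑ `c i`^σ > 1 for some σ > 1, and their limit
set has dimension at least σ. The index N must also exceed the p-fold logarithm of the largest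
modulus, so that the branches preserve a compact set; `exists_shiftedLog_sum` arranges both. The
dimension bound is `le_dimH_range_coding`, and the limit set is built in `exists_cantor_coding`.

The topological part shows that these branches follow the prescribed itinerary. For 1 ≤ j < p the
domain C_j avoids C_0, so it lies in H_{k_j}, and its imaginary parts are bounded
(`exists_im_bound_domC`). Hence the logarithmic image of a high half-plane, chosen to meet C_j,
avoids C_0 and lies in the same H_{k_j}. The last logarithm, taken on a quadrant, is placed with a
domain containing a right half-plane and disjoint from C_p (`exists_mem_strip_of_mem`). The result
is `exists_inverse_branches`.

On the limit set |(f^p)'| ≥ 2 and orbits are bounded, so it lies in the Julia set. All its entries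
s_n are at least N, which is larger than every |k_j|. -/

theorem continuous_expMap (lam : ℂ) : Continuous (expMap lam) := by
  unfold expMap; fun_prop

theorem expMap_ne_zero {lam : ℂ} (hlam : lam ≠ 0) (z : ℂ) : expMap lam z ≠ 0 :=
  mul_ne_zero hlam (Complex.exp_ne_zero z)

theorem expMap_add_int (lam z : ℂ) (s : ℤ) :
    expMap lam (z + 2 * Real.pi * Complex.I * s) = expMap lam z := by
  unfold expMap
  have : z + 2 * Real.pi * Complex.I * s = z + s * (2 * Real.pi * Complex.I) := by ring
  rw [this, Complex.exp_add, Complex.exp_int_mul_two_pi_mul_I, mul_one]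

theorem exists_int_of_expMap_eq {lam : ℂ} (hlam : lam ≠ 0) {z w : ℂ}
    (h : expMap lam z = expMap lam w) : ∃ n : ℤ, z = w + 2 * Real.pi * Complex.I * n := by
  obtain ⟨n, hn⟩ := Complex.exp_eq_exp_iff_exists_int.1 (mul_left_cancel₀ hlam h)
  exact ⟨n, by rw [hn]; ring⟩

theorem norm_expMap (lam z : ℂ) : ‖expMap lam z‖ = ‖lam‖ * Real.exp z.re := by
  rw [expMap, norm_mul, Complex.norm_exp]

theorem div_mem_slitPlane_of_mem_ball {y ζ : ℂ} {r : ℝ} (hr : r ≤ ‖y‖)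
    (h : ζ ∈ Metric.ball y r) : ζ / y ∈ Complex.slitPlane := by
  rw [Metric.mem_ball, dist_eq_norm] at h
  have hy : 0 < ‖y‖ := (norm_nonneg _).trans_lt (h.trans_le hr)
  have hy0 : y ≠ 0 := norm_pos_iff.1 hy
  have h1 : ‖ζ / y - 1‖ < 1 := by
    have : ζ / y - 1 = (ζ - y) / y := by field_simp
    rw [this, norm_div, div_lt_one hy]
    exact h.trans_le hr
  simpa using Complex.mem_slitPlane_of_norm_lt_one h1

/-- The image of a component of `f⁻¹(D)` contains every ball in `D` that it meets and that does
not contain the omitted value `0`. -/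
theorem ball_subset_image_component {lam : ℂ} (hlam : lam ≠ 0) {D : Set ℂ} {x y : ℂ} {r : ℝ}
    (hr : r ≤ ‖y‖) (hD : Metric.ball y r ⊆ D)
    (h : (expMap lam '' connectedComponentIn (expMap lam ⁻¹' D) x ∩ Metric.ball y r).Nonempty) :
    Metric.ball y r ⊆ expMap lam '' connectedComponentIn (expMap lam ⁻¹' D) x := by
  obtain ⟨_, ⟨k, hk, rfl⟩, hky⟩ := h
  -- The branch of the inverse on the ball, normalised to send the image of k back to k; ζ/y stays
  -- in the slit plane because the ball omits 0.
  set s : ℂ → ℂ := fun ζ => k + Complex.log (ζ / y) - Complex.log (expMap lam k / y) with hs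
  have hy : y ≠ 0 := by
    rintro rfl
    rw [norm_zero] at hr
    exact (Metric.pos_of_mem_ball hky).not_ge hr
  have hfs : ∀ ζ ∈ Metric.ball y r, expMap lam (s ζ) = ζ := by
    intro ζ hζ
    have h1 := Complex.slitPlane_ne_zero (div_mem_slitPlane_of_mem_ball hr hζ)
    have h2 := Complex.slitPlane_ne_zero (div_mem_slitPlane_of_mem_ball hr hky)
    simp only [hs, expMap, Complex.exp_add, Complex.exp_sub] at *
    rw [Complex.exp_log h1, Complex.exp_log h2]
    have := Complex.exp_ne_zero k
    field_simp
  have hcont : ContinuousOn s (Metric.ball y r) := by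
    intro ζ hζ
    have h1 := div_mem_slitPlane_of_mem_ball hr hζ
    apply ContinuousAt.continuousWithinAt
    exact (continuousAt_const.add ((continuousAt_id.div_const y).clog h1)).sub continuousAt_const
  have hconn : IsPreconnected (s '' Metric.ball y r) :=
    (convex_ball y r).isPreconnected.image _ hcont
  have hsub : s '' Metric.ball y r ⊆ expMap lam ⁻¹' D := by
    rintro _ ⟨ζ, hζ, rfl⟩
    rw [mem_preimage, hfs ζ hζ]
    exact hD hζ
  have hks : k ∈ s '' Metric.ball y r := ⟨_, hky, by simp [hs]⟩
  have := hconn.subset_connectedComponentIn hks hsub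
  rw [← connectedComponentIn_eq hk] at this
  intro ζ hζ
  exact ⟨s ζ, this ⟨ζ, hζ, rfl⟩, hfs ζ hζ⟩

/-- A component of the preimage of a domain is mapped onto the domain, unless its image
stays away from `0`. -/
theorem subset_image_component_aux {lam : ℂ} (hlam : lam ≠ 0) {D : Set ℂ} (hDo : IsOpen D)
    (hDc : IsPreconnected D) {x : ℂ} (hx : expMap lam x ∈ D)
    (h0 : (0 : ℂ) ∈ D → ∃ δ > 0,
      ∀ z ∈ connectedComponentIn (expMap lam ⁻¹' D) x, δ ≤ ‖expMap lam z‖) :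
    D ⊆ expMap lam '' connectedComponentIn (expMap lam ⁻¹' D) x := by
  intro y hy
  have key := hDc.induction₂
    (fun a b => a ∈ expMap lam '' connectedComponentIn (expMap lam ⁻¹' D) x ↔
      b ∈ expMap lam '' connectedComponentIn (expMap lam ⁻¹' D) x)
    (fun a ha => ?_) (fun _ _ _ _ _ _ => Iff.trans) (fun _ _ _ _ => Iff.symm) hx hy
  · exact key.1 ⟨x, mem_connectedComponentIn hx, rfl⟩
  -- Membership in the image is locally constant on D. Near 0 this holds because the image stays
  -- away from 0; elsewhere a small ball is either contained in the image or disjoint from it.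
  by_cases ha0 : a = 0
  · subst ha0
    obtain ⟨δ, hδ, h⟩ := h0 ha
    apply mem_nhdsWithin_of_mem_nhds
    filter_upwards [Metric.ball_mem_nhds (0 : ℂ) hδ] with b hb
    have hno : ∀ c ∈ Metric.ball (0 : ℂ) δ,
        c ∉ expMap lam '' connectedComponentIn (expMap lam ⁻¹' D) x := by
      rintro c hc ⟨z, hz, rfl⟩
      rw [mem_ball_zero_iff] at hc
      exact (h z hz).not_gt hc
    exact iff_of_false (hno 0 (Metric.mem_ball_self hδ)) (hno b hb)
  · obtain ⟨ε, hε, hεD⟩ := Metric.isOpen_iff.1 hDo a ha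
    set r := min ε ‖a‖
    have hr : 0 < r := lt_min hε (norm_pos_iff.2 ha0)
    have hrD : Metric.ball a r ⊆ D := (Metric.ball_subset_ball (min_le_left _ _)).trans hεD
    have hmain := ball_subset_image_component hlam (x := x) (min_le_right ε ‖a‖) hrD
    apply mem_nhdsWithin_of_mem_nhds
    filter_upwards [Metric.ball_mem_nhds a hr] with b hb
    exact ⟨fun h => hmain ⟨a, h, Metric.mem_ball_self hr⟩ hb,
      fun h => hmain ⟨b, h, hb⟩ (Metric.mem_ball_self hr)⟩

/-- A component of the preimage of a domain which omits `0` is mapped onto the domain. -/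
theorem image_component_eq {lam : ℂ} (hlam : lam ≠ 0) {D : Set ℂ} (hDo : IsOpen D)
    (hDc : IsPreconnected D) (h0 : (0 : ℂ) ∉ D) {x : ℂ} (hx : expMap lam x ∈ D) :
    expMap lam '' connectedComponentIn (expMap lam ⁻¹' D) x = D := by
  apply Subset.antisymm
  · rintro _ ⟨z, hz, rfl⟩
    exact (connectedComponentIn_subset _ _ hz : z ∈ expMap lam ⁻¹' D)
  · exact subset_image_component_aux hlam hDo hDc hx (fun h => (h0 h).elim)

theorem exists_halfPlane_subset_preimage {lam : ℂ} {D : Set ℂ} (hDo : IsOpen D)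
    (h0 : (0 : ℂ) ∈ D) : ∃ c : ℝ, {z : ℂ | z.re < c} ⊆ expMap lam ⁻¹' D := by
  obtain ⟨δ, hδ, hδD⟩ := Metric.isOpen_iff.1 hDo 0 h0
  have : Tendsto (fun t : ℝ => ‖lam‖ * Real.exp t) atBot (𝓝 (‖lam‖ * 0)) :=
    Real.tendsto_exp_atBot.const_mul _
  rw [mul_zero] at this
  obtain ⟨c, hc⟩ := eventually_atBot.1 (this.eventually_lt_const hδ)
  refine ⟨c, fun z hz => hδD ?_⟩
  rw [mem_ball_zero_iff, norm_expMap]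
  exact hc _ (le_of_lt hz)

theorem convex_re_lt (c : ℝ) : Convex ℝ {z : ℂ | z.re < c} :=
  convex_halfSpace_re_lt c

/-- The preimage of a domain containing `0` is connected. -/
theorem isConnected_preimage {lam : ℂ} (hlam : lam ≠ 0) {D : Set ℂ} (hDo : IsOpen D)
    (hDc : IsPreconnected D) (h0 : (0 : ℂ) ∈ D) : IsConnected (expMap lam ⁻¹' D) := by
  obtain ⟨δ, hδ, hδD⟩ := Metric.isOpen_iff.1 hDo 0 h0
  have hlam' : 0 < ‖lam‖ := norm_pos_iff.2 hlam
  set c := Real.log (δ / ‖lam‖)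
  have hiff : ∀ z : ℂ, ‖expMap lam z‖ < δ ↔ z.re < c := by
    intro z
    rw [norm_expMap, Real.lt_log_iff_exp_lt (by positivity), lt_div_iff₀ hlam', mul_comm]
  have hsub : {z : ℂ | z.re < c} ⊆ expMap lam ⁻¹' D := by
    intro z hz
    exact hδD (by rw [mem_ball_zero_iff]; exact (hiff z).2 hz)
  set x : ℂ := ((c - 1 : ℝ) : ℂ)
  have hx : x ∈ {z : ℂ | z.re < c} := by simp [x]
  have hH : {z : ℂ | z.re < c} ⊆ connectedComponentIn (expMap lam ⁻¹' D) x :=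
    (convex_re_lt c).isPreconnected.subset_connectedComponentIn hx hsub
  suffices h : expMap lam ⁻¹' D ⊆ connectedComponentIn (expMap lam ⁻¹' D) x by
    have := Subset.antisymm h (connectedComponentIn_subset _ _)
    rw [this]
    exact isConnected_connectedComponentIn_iff.2 (hsub hx)
  intro z hz
  by_contra hzx
  -- A component not containing the left half-plane {|f| < δ} is disjoint from it. It would then map
  -- onto D, which contains the omitted value 0.
  have h := subset_image_component_aux hlam hDo hDc (x := z) hz (fun _ => ⟨δ, hδ, fun u hu => ?_⟩) h0
  · obtain ⟨u, -, hu⟩ := h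
    exact expMap_ne_zero hlam u hu
  · by_contra! hlt
    have hux := hH ((hiff u).1 hlt)
    have h1 := connectedComponentIn_eq hux
    have h2 := connectedComponentIn_eq hu
    apply hzx
    rw [h1, ← h2]
    exact mem_connectedComponentIn hz

/-! ### Bounded branches of the logarithm and imaginary parts -/

/-- A continuous branch of `log ((ζ - a) / (ζ - b))` with bounded imaginary part exists outside a
domain containing `a` and `b`. -/
theorem exists_log_branch {P : Set ℂ} (hPo : IsOpen P) (hPc : IsPreconnected P) {a b : ℂ}
    (ha : a ∈ P) (hb : b ∈ P) :
    ∃ (l : ℂ → ℂ) (K : ℝ), ContinuousOn l Pᶜ ∧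
      ∀ ζ ∈ Pᶜ, Complex.exp (l ζ) = (ζ - a) / (ζ - b) ∧ |(l ζ).im| ≤ K := by
  have hne : ∀ c ∈ P, ∀ ζ ∈ Pᶜ, ζ - c ≠ 0 := fun c hc ζ hζ h => hζ (sub_eq_zero.1 h ▸ hc)
  refine hPc.induction₂ (fun a b => ∃ (l : ℂ → ℂ) (K : ℝ), ContinuousOn l Pᶜ ∧
      ∀ ζ ∈ Pᶜ, Complex.exp (l ζ) = (ζ - a) / (ζ - b) ∧ |(l ζ).im| ≤ K) ?_ ?_ ?_ ha hb
  · intro a ha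
    obtain ⟨r, hr, hrP⟩ := Metric.isOpen_iff.1 hPo a ha
    apply mem_nhdsWithin_of_mem_nhds
    filter_upwards [Metric.ball_mem_nhds a hr, hPo.mem_nhds ha] with b hb hbP
    have hslit : ∀ ζ ∈ Pᶜ, (ζ - b) / (ζ - a) ∈ Complex.slitPlane := by
      intro ζ hζ
      refine div_mem_slitPlane_of_mem_ball (r := r) ?_ ?_
      · by_contra! h
        exact hζ (hrP (by rwa [Metric.mem_ball, dist_eq_norm]))
      · rw [Metric.mem_ball, dist_eq_norm, sub_sub_sub_cancel_left, norm_sub_rev]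
        rwa [Metric.mem_ball, dist_eq_norm] at hb
    -- For b in a disc about a inside P the principal logarithm serves. Chaining such discs adds the
    -- bounds on the imaginary part.
    refine ⟨fun ζ => -Complex.log ((ζ - b) / (ζ - a)), Real.pi, ?_, fun ζ hζ => ⟨?_, ?_⟩⟩
    · intro ζ hζ
      apply ContinuousAt.continuousWithinAt
      apply ContinuousAt.neg
      refine ContinuousAt.clog ?_ (hslit ζ hζ)
      exact (continuousAt_id.sub continuousAt_const).div
        (continuousAt_id.sub continuousAt_const) (hne a ha ζ hζ)
    · rw [Complex.exp_neg, Complex.exp_log (Complex.slitPlane_ne_zero (hslit ζ hζ)), inv_div]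
    · rw [Complex.neg_im, abs_neg, Complex.log_im]
      exact Complex.abs_arg_le_pi _
  · rintro a b c ha hb hc ⟨l, K, hl, h⟩ ⟨l', K', hl', h'⟩
    refine ⟨fun ζ => l ζ + l' ζ, K + K', hl.add hl', fun ζ hζ => ⟨?_, ?_⟩⟩
    · rw [Complex.exp_add, (h ζ hζ).1, (h' ζ hζ).1]
      have := hne b hb ζ hζ
      have := hne c hc ζ hζ
      field_simp
    · rw [Complex.add_im]
      exact (abs_add_le _ _).trans (add_le_add (h ζ hζ).2 (h' ζ hζ).2)
  · rintro a b ha hb ⟨l, K, hl, h⟩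
    refine ⟨fun ζ => -l ζ, K, hl.neg, fun ζ hζ => ⟨?_, ?_⟩⟩
    · rw [Complex.exp_neg, (h ζ hζ).1, inv_div]
    · rw [Complex.neg_im, abs_neg]
      exact (h ζ hζ).2

theorem eq_of_exp_eq_const {S : Set ℂ} (hS : IsPreconnected S) {Φ : ℂ → ℂ}
    (hΦ : ContinuousOn Φ S) {c : ℂ} (hc : ∀ z ∈ S, Complex.exp (Φ z) = c) {z w : ℂ}
    (hz : z ∈ S) (hw : w ∈ S) : Φ z = Φ w := by
  refine hS.induction₂ (fun z w => Φ z = Φ w) ?_ (fun _ _ _ _ _ _ => Eq.trans)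
    (fun _ _ _ _ => Eq.symm) hz hw
  intro a ha
  have h1 := (hΦ a ha).eventually (Metric.ball_mem_nhds (Φ a) Real.two_pi_pos)
  filter_upwards [h1, self_mem_nhdsWithin] with b hb hbS
  obtain ⟨n, hn⟩ := Complex.exp_eq_exp_iff_exists_int.1 ((hc b hbS).trans (hc a ha).symm)
  rw [dist_eq_norm, hn, add_sub_cancel_left, norm_mul] at hb
  have h2 : ‖(2 * Real.pi * Complex.I : ℂ)‖ = 2 * Real.pi := by
    simp [abs_of_pos Real.pi_pos]
  rw [h2, Complex.norm_intCast] at hb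
  have h3 : |(n : ℝ)| < 1 := by
    by_contra! h
    nlinarith [Real.two_pi_pos]
  have h4 : n = 0 := by
    rw [← Int.cast_abs] at h3
    have : |n| < 1 := by exact_mod_cast h3
    exact Int.abs_lt_one_iff.1 this
  rw [hn, h4]
  simp

/-- If a domain contains `0` and a ray, then connected sets whose image avoids the domain
have bounded imaginary parts. -/
theorem exists_im_bound_of_disjoint {lam : ℂ} {P : Set ℂ} (hPo : IsOpen P)
    (hPc : IsPreconnected P) (h0 : (0 : ℂ) ∈ P) {a u : ℂ} (hu : u ≠ 0)
    (hray : ∀ t : ℝ, 0 ≤ t → a + u * t ∈ P) :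
    ∃ K : ℝ, ∀ S : Set ℂ, IsPreconnected S → (∀ z ∈ S, expMap lam z ∉ P) →
      ∀ z ∈ S, ∀ w ∈ S, |z.im - w.im| ≤ K := by
  have ha : a ∈ P := by simpa using hray 0 le_rfl
  obtain ⟨l, K, hl, h⟩ := exists_log_branch hPo hPc h0 ha
  have hslit : ∀ ζ ∈ Pᶜ, (ζ - a) / (-u) ∈ Complex.slitPlane := by
    intro ζ hζ
    by_contra hcon
    rw [Complex.mem_slitPlane_iff] at hcon
    push Not at hcon
    apply hζ
    have := hray (-((ζ - a) / (-u)).re) (by linarith [hcon.1])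
    have h2 : (((ζ - a) / (-u)).re : ℂ) = (ζ - a) / (-u) := by
      apply Complex.ext <;> simp [hcon.2]
    rw [Complex.ofReal_neg, h2] at this
    convert this using 1
    field_simp
    ring
  refine ⟨K + Real.pi + (K + Real.pi), fun S hS hSP z hz w hw => ?_⟩
  -- With ζ = f(z), exp Φ = ζ/(ζ - a) · (ζ - a)/(-u) / e^z = λ/(-u). Thus Φ is constant on S, and Im
  -- z is, up to a constant, a sum of two bounded terms.
  set Φ : ℂ → ℂ := fun z =>
    l (expMap lam z) + Complex.log ((expMap lam z - a) / (-u)) - z with hΦ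
  have hcont : ContinuousOn Φ S := by
    refine ContinuousOn.sub (ContinuousOn.add ?_ ?_) continuousOn_id
    · exact hl.comp (continuous_expMap lam).continuousOn hSP
    · refine ContinuousOn.clog ?_ (fun z hz => hslit _ (hSP z hz))
      exact ((continuous_expMap lam).continuousOn.sub continuousOn_const).div_const _
  have hexp : ∀ z ∈ S, Complex.exp (Φ z) = lam / (-u) := by
    intro z hz
    have h1 := hslit _ (hSP z hz)
    have hne : expMap lam z - a ≠ 0 := fun h => hSP z hz (sub_eq_zero.1 h ▸ ha)
    simp only [hΦ]
    rw [Complex.exp_sub, Complex.exp_add, Complex.exp_log (Complex.slitPlane_ne_zero h1),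
      (h _ (hSP z hz)).1, sub_zero]
    have := Complex.exp_ne_zero z
    field_simp
    simp [expMap, mul_comm]
  have heq := congrArg Complex.im (eq_of_exp_eq_const hS hcont hexp hz hw)
  simp only [hΦ, Complex.sub_im, Complex.add_im, Complex.log_im] at heq
  have b1 := abs_le.1 (h _ (hSP z hz)).2
  have b2 := abs_le.1 (h _ (hSP w hw)).2
  have b3 := abs_le.1 (Complex.abs_arg_le_pi ((expMap lam z - a) / (-u)))
  have b4 := abs_le.1 (Complex.abs_arg_le_pi ((expMap lam w - a) / (-u)))
  rw [abs_le]
  constructor <;> linarith [b1.1, b1.2, b2.1, b2.2, b3.1, b3.2, b4.1, b4.2]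

/-! ### Basins of the points of an attracting cycle -/

/-- The points which are attracted by `x` under the iterates of `f^p`. -/
def attractedTo (f : ℂ → ℂ) (p : ℕ) (x : ℂ) : Set ℂ :=
  {z | Tendsto (fun n : ℕ => f^[n * p] z) atTop (𝓝 x)}

theorem eq_of_mem_attractedTo {f : ℂ → ℂ} {p : ℕ} {x y z : ℂ} (hx : z ∈ attractedTo f p x)
    (hy : z ∈ attractedTo f p y) : x = y :=
  tendsto_nhds_unique hx hy

theorem exists_ball_subset_attractedTo {f : ℂ → ℂ} {p : ℕ} {x : ℂ}
    (hd : DifferentiableAt ℂ f^[p] x) (hx : f^[p] x = x) (hm : ‖deriv f^[p] x‖ < 1) :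
    ∃ ε > 0, Metric.ball x ε ⊆ attractedTo f p x := by
  obtain ⟨c, hc1, hc2⟩ := exists_between hm
  have hc0 : 0 < c := (norm_nonneg _).trans_lt hc1
  have h1 := (hasDerivAt_iff_isLittleO.1 hd.hasDerivAt).bound (sub_pos.2 hc1)
  obtain ⟨ε, hε, h2⟩ := Metric.eventually_nhds_iff_ball.1 h1
  have h3 : ∀ z ∈ Metric.ball x ε, ‖f^[p] z - x‖ ≤ c * ‖z - x‖ := by
    intro z hz
    have h4 := h2 z hz
    rw [hx, smul_eq_mul] at h4
    calc ‖f^[p] z - x‖ = ‖(f^[p] z - x - (z - x) * deriv f^[p] x) + (z - x) * deriv f^[p] x‖ := by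
          ring_nf
      _ ≤ _ := norm_add_le _ _
      _ ≤ (c - ‖deriv f^[p] x‖) * ‖z - x‖ + ‖z - x‖ * ‖deriv f^[p] x‖ := by
          rw [norm_mul]; gcongr
      _ = c * ‖z - x‖ := by ring
  refine ⟨ε, hε, fun z hz => ?_⟩
  have h5 : ∀ n : ℕ, ‖f^[n * p] z - x‖ ≤ c ^ n * ‖z - x‖ := by
    intro n
    induction n with
    | zero => simp
    | succ n ih =>
      have hmem : f^[n * p] z ∈ Metric.ball x ε := by
        rw [Metric.mem_ball, dist_eq_norm] at hz ⊢
        refine (ih.trans ?_).trans_lt hz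
        exact mul_le_of_le_one_left (norm_nonneg _) (pow_le_one₀ hc0.le hc2.le)
      have : f^[(n + 1) * p] z = f^[p] (f^[n * p] z) := by
        rw [← iterate_add_apply]; congr 1; ring
      rw [this]
      calc _ ≤ c * ‖f^[n * p] z - x‖ := h3 _ hmem
        _ ≤ c * (c ^ n * ‖z - x‖) := by gcongr
        _ = _ := by ring
  have h6 : Tendsto (fun n : ℕ => c ^ n * ‖z - x‖) atTop (𝓝 0) := by
    simpa using (tendsto_pow_atTop_nhds_zero_of_lt_one hc0.le hc2).mul_const ‖z - x‖
  exact tendsto_iff_norm_sub_tendsto_zero.2 (squeeze_zero (fun _ => norm_nonneg _) h5 h6)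

theorem isOpen_attractedTo {f : ℂ → ℂ} (hf : Continuous f) {p : ℕ} {x : ℂ} {ε : ℝ} (hε : 0 < ε)
    (h : Metric.ball x ε ⊆ attractedTo f p x) : IsOpen (attractedTo f p x) := by
  rw [isOpen_iff_mem_nhds]
  intro z hz
  obtain ⟨N, hN⟩ := (hz.eventually (Metric.ball_mem_nhds x hε)).exists
  have : f^[N * p] ⁻¹' Metric.ball x ε ∈ 𝓝 z :=
    (Metric.isOpen_ball.preimage (hf.iterate _)).mem_nhds hN
  filter_upwards [this] with w hw
  have h1 : Tendsto (fun n : ℕ => f^[n * p] (f^[N * p] w)) atTop (𝓝 x) := h hw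
  simp only [← iterate_add_apply, ← add_mul] at h1
  exact (tendsto_add_atTop_iff_nat (f := fun n : ℕ => f^[n * p] w) N).1 h1

theorem differentiable_expMap_iterate (lam : ℂ) (n : ℕ) : Differentiable ℂ (expMap lam)^[n] := by
  induction n with
  | zero => exact differentiable_id
  | succ n ih =>
    rw [iterate_succ']
    refine Differentiable.comp ?_ ih
    unfold expMap
    fun_prop

theorem IsAttractingCycle.iterate_period {f : ℂ → ℂ} {p : ℕ} {z₀ : ℂ}
    (h : IsAttractingCycle f p z₀) (j : ℕ) : f^[p] (f^[j] z₀) = f^[j] z₀ := by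
  rw [← iterate_add_apply, add_comm, iterate_add_apply, ← h.minimalPeriod_eq,
    iterate_minimalPeriod]

theorem mem_attractedTo_iff {f : ℂ → ℂ} (hf : Continuous f) {p : ℕ} {z₀ : ℂ}
    (h : IsAttractingCycle f p z₀) (j : ℕ) (z : ℂ) :
    f z ∈ attractedTo f p (f^[j + 1] z₀) ↔ z ∈ attractedTo f p (f^[j] z₀) := by
  constructor
  · intro hz
    have h1 : Tendsto (fun n : ℕ => f^[p - 1] (f^[n * p] (f z))) atTop
        (𝓝 (f^[p - 1] (f^[j + 1] z₀))) := ((hf.iterate (p - 1)).tendsto _).comp hz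
    have hp := h.pos
    rw [← iterate_add_apply, show p - 1 + (j + 1) = p + j by omega, iterate_add_apply,
      h.iterate_period] at h1
    refine (tendsto_add_atTop_iff_nat (f := fun n : ℕ => f^[n * p] z) 1).1 (h1.congr fun n => ?_)
    rw [← iterate_succ_apply, ← iterate_add_apply]
    congr 1
    rw [add_mul]
    omega
  · intro hz
    rw [iterate_succ_apply']
    refine ((hf.tendsto _).comp hz).congr fun n => ?_
    rw [comp_apply, ← iterate_succ_apply f, ← iterate_succ_apply' f]

theorem iterate_mem_attractedTo_iff {f : ℂ → ℂ} (hf : Continuous f) {p : ℕ} {z₀ : ℂ}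
    (h : IsAttractingCycle f p z₀) (m j : ℕ) (z : ℂ) :
    f^[m] z ∈ attractedTo f p (f^[j + m] z₀) ↔ z ∈ attractedTo f p (f^[j] z₀) := by
  induction m generalizing j with
  | zero => rfl
  | succ m ih =>
    rw [iterate_succ_apply', ← add_assoc, mem_attractedTo_iff hf h, ih]

/-- The multiplier condition is given at z₀ only. The other basins are preimages of that of z₀,
since `f^[j * (p - 1)]` sends z_j to z₀. -/
theorem isOpen_attractedTo_iterate {lam : ℂ} {p : ℕ} {z₀ : ℂ}
    (h : IsAttractingCycle (expMap lam) p z₀) (j : ℕ) :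
    IsOpen (attractedTo (expMap lam) p ((expMap lam)^[j] z₀)) := by
  obtain ⟨ε, hε, hsub⟩ := exists_ball_subset_attractedTo
    (differentiable_expMap_iterate lam p z₀) (h.iterate_period 0) h.multiplier_lt
  have h0 := isOpen_attractedTo (continuous_expMap lam) hε hsub
  have h1 : (expMap lam)^[j + j * (p - 1)] z₀ = z₀ := by
    have : j + j * (p - 1) = j * p := by
      have := h.pos
      obtain ⟨q, rfl⟩ : ∃ q, p = q + 1 := ⟨p - 1, by omega⟩
      simp; ring
    rw [this, mul_comm, iterate_mul]
    exact iterate_fixed (h.iterate_period 0) j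
  have h2 : attractedTo (expMap lam) p ((expMap lam)^[j] z₀) =
      (expMap lam)^[j * (p - 1)] ⁻¹' attractedTo (expMap lam) p z₀ := by
    ext z
    rw [← iterate_mem_attractedTo_iff (continuous_expMap lam) h (j * (p - 1)), h1]
    rfl
  rw [h2]
  exact h0.preimage ((continuous_expMap lam).iterate _)

theorem IsAttractingCycle.eq_of_iterate_eq {f : ℂ → ℂ} {p : ℕ} {z₀ : ℂ}
    (h : IsAttractingCycle f p z₀) {i j : ℕ} (hi : 1 ≤ i) (hip : i ≤ p) (hj : 1 ≤ j)
    (hjp : j ≤ p) (he : f^[i] z₀ = f^[j] z₀) : i = j := by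
  have hp := h.pos
  have h1 : f^[i % p] z₀ = f^[j % p] z₀ := by
    rw [← h.minimalPeriod_eq, iterate_mod_minimalPeriod_eq, iterate_mod_minimalPeriod_eq, he]
  have h2 := (iterate_eq_iterate_iff_of_lt_minimalPeriod
    (by rw [h.minimalPeriod_eq]; exact Nat.mod_lt _ hp)
    (by rw [h.minimalPeriod_eq]; exact Nat.mod_lt _ hp)).1 h1
  rcases hip.eq_or_lt with rfl | hip
  · rcases hjp.eq_or_lt with rfl | hjp
    · rfl
    · rw [Nat.mod_self, Nat.mod_eq_of_lt hjp] at h2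
      omega
  · rcases hjp.eq_or_lt with rfl | hjp
    · rw [Nat.mod_self, Nat.mod_eq_of_lt hip] at h2
      omega
    · rwa [Nat.mod_eq_of_lt hjp, Nat.mod_eq_of_lt hip] at h2

/-- The sets attracted to distinct points of the cycle are open, disjoint and cover the basin, so a
connected subset lies in one of them. -/
theorem basinComp_subset_attractedTo {lam : ℂ} {p : ℕ} {z₀ : ℂ}
    (h : IsAttractingCycle (expMap lam) p z₀) (j : ℕ) :
    basinComp (expMap lam) p z₀ j ⊆ attractedTo (expMap lam) p ((expMap lam)^[j] z₀) := by
  set f := expMap lam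
  have hj : f^[j] z₀ ∈ attractedTo f p (f^[j] z₀) := by
    refine tendsto_const_nhds.congr fun n => ?_
    rw [mul_comm, iterate_mul]
    exact (iterate_fixed (h.iterate_period j) n).symm
  have hmem : f^[j] z₀ ∈ basin f p z₀ := ⟨j, hj⟩
  set V := ⋃ i ∈ {i : ℕ | f^[i] z₀ ≠ f^[j] z₀}, attractedTo f p (f^[i] z₀)
  have hV : IsOpen V := isOpen_biUnion fun i _ => isOpen_attractedTo_iterate h i
  have hdisj : Disjoint (attractedTo f p (f^[j] z₀)) V := by
    rw [Set.disjoint_left]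
    intro z hz hzV
    obtain ⟨i, hi, hzi⟩ := mem_iUnion₂.1 hzV
    exact hi (eq_of_mem_attractedTo hzi hz)
  refine isPreconnected_connectedComponentIn.subset_left_of_subset_union
    (isOpen_attractedTo_iterate h j) hV hdisj ?_ ⟨_, mem_connectedComponentIn hmem, hj⟩
  intro z hz
  obtain ⟨i, hi⟩ := connectedComponentIn_subset _ _ hz
  by_cases hij : f^[i] z₀ = f^[j] z₀
  · left
    rw [← hij]
    exact hi
  · exact Or.inr (mem_iUnion₂.2 ⟨i, hij, hi⟩)

/-! ### The domains `C_j` -/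

/-- The domain `C_j` for `1 ≤ j ≤ p`. -/
def domC (f : ℂ → ℂ) (p : ℕ) (z₀ : ℂ) (C : Set ℂ) (j : ℕ) : Set ℂ := pullBack f p z₀ C (p - j)

theorem domC_eq {f : ℂ → ℂ} {p : ℕ} {z₀ : ℂ} {C : Set ℂ} {j : ℕ} (hj : j < p) :
    domC f p z₀ C j = connectedComponentIn (f ⁻¹' domC f p z₀ C (j + 1)) (f^[j] z₀) := by
  obtain ⟨i, hi⟩ : ∃ i, p - j = i + 1 := ⟨p - j - 1, by omega⟩
  rw [domC, domC, hi, pullBack, show p - (j + 1) = i by omega, show p - (i + 1) = j by omega]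

theorem domC_self {f : ℂ → ℂ} {p : ℕ} {z₀ : ℂ} {C : Set ℂ} : domC f p z₀ C p = C := by
  rw [domC, Nat.sub_self, pullBack]

section

variable {lam : ℂ} {p : ℕ} {z₀ : ℂ} {B C : Set ℂ}

theorem iterate_mem_domC (hcycle : IsAttractingCycle (expMap lam) p z₀)
    (h : IsBasinConstruction (expMap lam) p z₀ B C) {j : ℕ} (hj : j ≤ p) :
    (expMap lam)^[j] z₀ ∈ domC (expMap lam) p z₀ C j := by
  induction hj using Nat.decreasingInduction with
  | self => rw [domC_self, ← iterate_zero_apply (expMap lam) z₀, hcycle.iterate_period]; exact h.z0_mem_C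
  | of_succ j hj ih =>
    rw [domC_eq hj]
    refine mem_connectedComponentIn ?_
    rwa [mem_preimage, ← iterate_succ_apply' (expMap lam)]

theorem isOpen_domC (h : IsBasinConstruction (expMap lam) p z₀ B C) {j : ℕ} (hj : j ≤ p) :
    IsOpen (domC (expMap lam) p z₀ C j) := by
  induction hj using Nat.decreasingInduction with
  | self => rw [domC_self]; exact h.isOpen_C
  | of_succ j hj ih =>
    rw [domC_eq hj]
    exact (ih.preimage (continuous_expMap lam)).connectedComponentIn

theorem isPreconnected_domC (h : IsBasinConstruction (expMap lam) p z₀ B C) {j : ℕ} (hj : j ≤ p) :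
    IsPreconnected (domC (expMap lam) p z₀ C j) := by
  rcases hj.eq_or_lt with rfl | hj
  · rw [domC_self]; exact h.isConnected_C.isPreconnected
  · rw [domC_eq hj]
    exact isPreconnected_connectedComponentIn

theorem expMap_mem_domC {j : ℕ} (hj : j < p) {z : ℂ} (hz : z ∈ domC (expMap lam) p z₀ C j) :
    expMap lam z ∈ domC (expMap lam) p z₀ C (j + 1) := by
  rw [domC_eq hj] at hz
  exact (connectedComponentIn_subset _ _ hz :
    z ∈ expMap lam ⁻¹' domC (expMap lam) p z₀ C (j + 1))

theorem expMap_iterate_mem_domC {i j : ℕ} (hj : j + i ≤ p) {z : ℂ}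
    (hz : z ∈ domC (expMap lam) p z₀ C j) :
    (expMap lam)^[i] z ∈ domC (expMap lam) p z₀ C (j + i) := by
  induction i with
  | zero => exact hz
  | succ i ih =>
    rw [iterate_succ_apply']
    exact expMap_mem_domC (j := j + i) (by omega) (ih (by omega))

theorem subset_attractedTo_one (hcycle : IsAttractingCycle (expMap lam) p z₀)
    (h : IsBasinConstruction (expMap lam) p z₀ B C) :
    B ⊆ attractedTo (expMap lam) p ((expMap lam)^[1] z₀) :=
  h.B_subset.trans (basinComp_subset_attractedTo hcycle 1)

theorem domC_subset_attractedTo (hcycle : IsAttractingCycle (expMap lam) p z₀)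
    (h : IsBasinConstruction (expMap lam) p z₀ B C) {j : ℕ} (hj : j ≤ p) :
    domC (expMap lam) p z₀ C j ⊆ attractedTo (expMap lam) p ((expMap lam)^[j] z₀) := by
  induction hj using Nat.decreasingInduction with
  | self =>
    rw [domC_self, ← iterate_zero_apply (expMap lam) z₀, hcycle.iterate_period]
    intro z hz
    exact (mem_attractedTo_iff (continuous_expMap lam) hcycle 0 z).1
      (subset_attractedTo_one hcycle h (h.C_subset hz))
  | of_succ j hj ih =>
    intro z hz
    exact (mem_attractedTo_iff (continuous_expMap lam) hcycle j z).1 (ih (expMap_mem_domC hj hz))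

/-- Points of C_i and C_j converge under `f^p` to different points of the cycle. -/
theorem eq_of_mem_domC (hcycle : IsAttractingCycle (expMap lam) p z₀)
    (h : IsBasinConstruction (expMap lam) p z₀ B C) {i j : ℕ} (hi : 1 ≤ i) (hip : i ≤ p)
    (hj : 1 ≤ j) (hjp : j ≤ p) {z : ℂ} (hzi : z ∈ domC (expMap lam) p z₀ C i)
    (hzj : z ∈ domC (expMap lam) p z₀ C j) : i = j :=
  hcycle.eq_of_iterate_eq hi hip hj hjp (eq_of_mem_attractedTo
    (domC_subset_attractedTo hcycle h hip hzi) (domC_subset_attractedTo hcycle h hjp hzj))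

theorem zero_mem_domC_one (h : IsBasinConstruction (expMap lam) p z₀ B C) :
    (0 : ℂ) ∈ domC (expMap lam) p z₀ C 1 :=
  h.closure_B_subset (subset_closure h.zero_mem_B)

/-- Since 0 lies in C_1, the other C_{j+1} omit 0, and the surjectivity of components onto such
domains applies. -/
theorem image_domC (hlam : lam ≠ 0) (hcycle : IsAttractingCycle (expMap lam) p z₀)
    (h : IsBasinConstruction (expMap lam) p z₀ B C) {j : ℕ} (hj : 1 ≤ j) (hjp : j < p) :
    expMap lam '' domC (expMap lam) p z₀ C j = domC (expMap lam) p z₀ C (j + 1) := by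
  rw [domC_eq hjp]
  refine image_component_eq hlam (isOpen_domC h hjp) (isPreconnected_domC h hjp) (fun h0 => ?_) ?_
  · have := eq_of_mem_domC hcycle h (by omega) (by omega) le_rfl (by omega) h0
      (zero_mem_domC_one h)
    omega
  · rw [← iterate_succ_apply' (expMap lam)]
    exact iterate_mem_domC hcycle h hjp

theorem notMem_domC0 (hcycle : IsAttractingCycle (expMap lam) p z₀)
    (h : IsBasinConstruction (expMap lam) p z₀ B C) {j : ℕ} (hj : 1 ≤ j) (hjp : j < p) {z : ℂ}
    (hz : z ∈ domC (expMap lam) p z₀ C j) : z ∉ domC0 (expMap lam) p z₀ C := by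
  intro h0
  have := eq_of_mem_domC hcycle h le_rfl (by omega) (by omega) (by omega)
    (show expMap lam z ∈ domC (expMap lam) p z₀ C 1 from h0) (expMap_mem_domC hjp hz)
  omega

/-- C_p contains a left half-plane, hence is unbounded. If C_{j+1} is unbounded, its preimages in
C_j have arbitrarily large real part, so C_j is unbounded too. -/
theorem exists_mem_domC_re_gt (hlam : lam ≠ 0) (hcycle : IsAttractingCycle (expMap lam) p z₀)
    (h : IsBasinConstruction (expMap lam) p z₀ B C) {j : ℕ} (hj : 1 ≤ j) (hjp : j < p) (r : ℝ) :
    ∃ z ∈ domC (expMap lam) p z₀ C j, r < z.re := by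
  have hlam' : 0 < ‖lam‖ := norm_pos_iff.2 hlam
  have step : ∀ i, 1 ≤ i → i < p → (∀ r : ℝ, ∃ z ∈ domC (expMap lam) p z₀ C (i + 1), r < ‖z‖) →
      ∀ r : ℝ, ∃ z ∈ domC (expMap lam) p z₀ C i, r < z.re := by
    intro i hi hip hr r
    obtain ⟨w, hw, hrw⟩ := hr (‖lam‖ * Real.exp r)
    rw [← image_domC hlam hcycle h hi hip] at hw
    obtain ⟨z, hz, rfl⟩ := hw
    refine ⟨z, hz, ?_⟩
    rw [norm_expMap] at hrw
    exact Real.exp_lt_exp.1 (lt_of_mul_lt_mul_left hrw hlam'.le)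
  suffices hS : ∀ i, i ≤ p → 1 ≤ i → ∀ r : ℝ, ∃ z ∈ domC (expMap lam) p z₀ C i, r < ‖z‖ from
    step j hj hjp (hS (j + 1) hjp (by omega)) r
  intro i hi
  induction hi using Nat.decreasingInduction with
  | self =>
    intro _ r
    obtain ⟨c, hc⟩ := h.leftHalfPlane_C
    refine ⟨((min (c - 1) (-|r| - 1) : ℝ) : ℂ), ?_, ?_⟩
    · rw [domC_self]
      apply hc
      simp only [mem_ofPred_eq, Complex.ofReal_re]
      linarith [min_le_left (c - 1) (-|r| - 1)]
    · rw [Complex.norm_real, Real.norm_eq_abs]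
      have := min_le_right (c - 1) (-|r| - 1)
      have := neg_le_abs (min (c - 1) (-|r| - 1))
      have := le_abs_self r
      linarith
  | of_succ i hi ih =>
    intro h1 r
    obtain ⟨z, hz, hr⟩ := step i h1 hi (ih (by omega)) r
    exact ⟨z, hz, hr.trans_le (Complex.re_le_norm z)⟩

theorem isPreconnected_norm_gt (r : ℝ) : IsPreconnected {z : ℂ | r < ‖z‖} := by
  rcases lt_or_ge r 0 with hr | hr
  · convert! (isPreconnected_univ : IsPreconnected (univ : Set ℂ)) using 1
    exact eq_univ_of_forall fun z => hr.trans_le (norm_nonneg z)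
  have : {z : ℂ | r < ‖z‖} = Complex.exp '' {z : ℂ | r < Real.exp z.re} := by
    ext z
    constructor
    · intro hz
      have hz0 : z ≠ 0 := norm_pos_iff.1 (hr.trans_lt hz)
      refine ⟨Complex.log z, ?_, Complex.exp_log hz0⟩
      rwa [mem_ofPred_eq, Complex.log_re, Real.exp_log (norm_pos_iff.2 hz0)]
    · rintro ⟨w, hw, rfl⟩
      rwa [mem_ofPred_eq, Complex.norm_exp]
  rw [this]
  refine IsPreconnected.image (Convex.isPreconnected ?_) _ Complex.continuous_exp.continuousOn
  rcases hr.eq_or_lt with rfl | hr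
  · convert! (convex_univ : Convex ℝ (univ : Set ℂ)) using 1
    exact eq_univ_of_forall fun z => Real.exp_pos _
  · convert! convex_halfSpace_re_gt (Real.log r) using 1
    ext z
    exact (Real.log_lt_iff_lt_exp hr).symm

theorem exists_re_lt_of_mem (hlam : lam ≠ 0) (hp : 1 < p)
    (hcycle : IsAttractingCycle (expMap lam) p z₀)
    (h : IsBasinConstruction (expMap lam) p z₀ B C) : ∃ b : ℝ, ∀ z ∈ C, z.re < b := by
  have hlam' : 0 < ‖lam‖ := norm_pos_iff.2 hlam
  obtain ⟨γ, hγ, -, hγB⟩ := h.jordan_B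
  have hcpt : IsCompact (frontier B) := hγB ▸ isCompact_range hγ
  obtain ⟨r, hr⟩ := hcpt.isBounded.exists_norm_le
  obtain ⟨c, hc⟩ := h.leftHalfPlane_C
  have hbdd : ∀ z ∈ B, ‖z‖ ≤ r := by
    intro z hz
    by_contra! hzr
    set x : ℂ := ((min (c - 1) (-|r| - 1) : ℝ) : ℂ)
    have hxC : x ∈ C := by
      apply hc
      simp only [mem_ofPred_eq, x, Complex.ofReal_re]
      linarith [min_le_left (c - 1) (-|r| - 1)]
    have hxr : x ∈ {z : ℂ | r < ‖z‖} := by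
      rw [mem_ofPred_eq, Complex.norm_real, Real.norm_eq_abs]
      have := min_le_right (c - 1) (-|r| - 1)
      have := neg_le_abs (min (c - 1) (-|r| - 1))
      have := le_abs_self r
      linarith
    -- Here p > 1 enters: C is attracted to z_0 and B to z_1, and these differ.
    have hxB : x ∉ B := by
      intro hxB
      rw [← domC_self (f := expMap lam) (p := p) (z₀ := z₀) (C := C)] at hxC
      have h1 := domC_subset_attractedTo hcycle h le_rfl hxC
      have h2 := subset_attractedTo_one hcycle h hxB
      have := hcycle.eq_of_iterate_eq (by omega) le_rfl le_rfl (by omega)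
        (eq_of_mem_attractedTo h1 h2)
      omega
    -- The connected set {|z| > r} misses the frontier of B. As it meets B, it would lie in B
    -- entirely.
    refine hxB ((isPreconnected_norm_gt r).subset_left_of_subset_union h.isOpen_B
      isClosed_closure.isOpen_compl (disjoint_compl_right_iff_subset.2 subset_closure)
      (fun y hy => ?_) ⟨z, hzr, hz⟩ hxr)
    by_contra hyB
    rw [mem_union, mem_compl_iff, not_or, not_not] at hyB
    refine (hr y ?_).not_gt hy
    rw [h.isOpen_B.frontier_eq]
    exact ⟨hyB.2, hyB.1⟩
  have hr0 : 0 ≤ r := (norm_nonneg _).trans (hbdd 0 h.zero_mem_B)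
  refine ⟨Real.log ((r + 1) / ‖lam‖), fun z hz => ?_⟩
  rw [Real.lt_log_iff_exp_lt (by positivity), lt_div_iff₀ hlam', mul_comm, ← norm_expMap]
  linarith [hbdd _ (h.C_subset hz)]

end

/-! ### Domains which separate the `C_j` from infinity -/

/-- A right half-plane together with the domains `C_1, …, C_{p-1}`. -/
def rightDomain (f : ℂ → ℂ) (p : ℕ) (z₀ : ℂ) (C : Set ℂ) (b : ℝ) : Set ℂ :=
  {z | b < z.re} ∪ ⋃ j ∈ {j : ℕ | 1 ≤ j ∧ j < p}, domC f p z₀ C j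

section

variable {lam : ℂ} {p : ℕ} {z₀ : ℂ} {B C : Set ℂ} {b : ℝ}

theorem domC_subset_rightDomain {f : ℂ → ℂ} {j : ℕ} (hj : 1 ≤ j) (hjp : j < p) :
    domC f p z₀ C j ⊆ rightDomain f p z₀ C b := fun _ hz =>
  Or.inr (mem_biUnion (show j ∈ {j : ℕ | 1 ≤ j ∧ j < p} from ⟨hj, hjp⟩) hz)

theorem isOpen_rightDomain (h : IsBasinConstruction (expMap lam) p z₀ B C) :
    IsOpen (rightDomain (expMap lam) p z₀ C b) :=
  (isOpen_lt continuous_const Complex.continuous_re).union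
    (isOpen_biUnion fun _ hj => isOpen_domC h hj.2.le)

/-- Each C_j with 1 ≤ j < p reaches into the half-plane Re z > b. -/
theorem isPreconnected_rightDomain (hlam : lam ≠ 0)
    (hcycle : IsAttractingCycle (expMap lam) p z₀)
    (h : IsBasinConstruction (expMap lam) p z₀ B C) :
    IsPreconnected (rightDomain (expMap lam) p z₀ C b) := by
  have hH : IsPreconnected {z : ℂ | b < z.re} := (convex_halfSpace_re_gt b).isPreconnected
  have hx : ((b + 1 : ℝ) : ℂ) ∈ {z : ℂ | b < z.re} := by simp
  refine isPreconnected_of_forall ((b + 1 : ℝ) : ℂ) (fun y hy => ?_)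
  rcases hy with hy | hy
  · exact ⟨_, subset_union_left, hx, hy, hH⟩
  · obtain ⟨j, hj, hyj⟩ := mem_iUnion₂.1 hy
    obtain ⟨z, hz, hbz⟩ := exists_mem_domC_re_gt hlam hcycle h hj.1 hj.2 b
    exact ⟨_, union_subset subset_union_left (domC_subset_rightDomain hj.1 hj.2),
      Or.inl hx, Or.inr hyj, hH.union z hbz hz (isPreconnected_domC h hj.2.le)⟩

theorem zero_mem_preimage_rightDomain (h : IsBasinConstruction (expMap lam) p z₀ B C) {i : ℕ}
    (hi : i + 1 < p) : (0 : ℂ) ∈ (expMap lam)^[i] ⁻¹' rightDomain (expMap lam) p z₀ C b :=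
  domC_subset_rightDomain (by omega : 1 ≤ 1 + i) (by omega)
    (expMap_iterate_mem_domC (by omega) (zero_mem_domC_one h))

theorem isOpen_preimage_rightDomain (h : IsBasinConstruction (expMap lam) p z₀ B C) (i : ℕ) :
    IsOpen ((expMap lam)^[i] ⁻¹' rightDomain (expMap lam) p z₀ C b) :=
  (isOpen_rightDomain h).preimage ((continuous_expMap lam).iterate i)

theorem isPreconnected_preimage_rightDomain (hlam : lam ≠ 0)
    (hcycle : IsAttractingCycle (expMap lam) p z₀)
    (h : IsBasinConstruction (expMap lam) p z₀ B C) {i : ℕ} (hi : i < p) :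
    IsPreconnected ((expMap lam)^[i] ⁻¹' rightDomain (expMap lam) p z₀ C b) := by
  induction i with
  | zero => exact isPreconnected_rightDomain hlam hcycle h
  | succ i ih =>
    exact (isConnected_preimage hlam (isOpen_preimage_rightDomain h i) (ih (by omega))
      (zero_mem_preimage_rightDomain h hi)).isPreconnected

/-- `f^i` maps C_{p-i} into C_p, which lies to the left of b and is disjoint from C_1, …, C_{p-1}.
-/
theorem notMem_preimage_rightDomain (hcycle : IsAttractingCycle (expMap lam) p z₀)
    (h : IsBasinConstruction (expMap lam) p z₀ B C) (hb : ∀ z ∈ C, z.re < b) {i j : ℕ}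
    (hij : j + i = p) {z : ℂ} (hz : z ∈ domC (expMap lam) p z₀ C j) :
    z ∉ (expMap lam)^[i] ⁻¹' rightDomain (expMap lam) p z₀ C b := by
  have hp := hcycle.pos
  have h1 := expMap_iterate_mem_domC hij.le hz
  rw [hij] at h1
  rintro (h2 | h2)
  · rw [domC_self] at h1
    exact (hb _ h1).not_gt h2
  · obtain ⟨l, hl, h3⟩ := mem_iUnion₂.1 h2
    have := eq_of_mem_domC hcycle h hl.1 hl.2.le hp le_rfl h3 h1
    exact hl.2.ne this

/-- C_{j+1} is disjoint from the preimage of `rightDomain` under `f^{p-j-1}`. This preimage is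
connected and contains 0 and a ray, to the right if j = p - 1 and to the left otherwise, so a branch
of the logarithm with bounded imaginary part exists off it. -/
theorem exists_im_bound_domC (hlam : lam ≠ 0)
    (hcycle : IsAttractingCycle (expMap lam) p z₀)
    (h : IsBasinConstruction (expMap lam) p z₀ B C) (hb : ∀ z ∈ C, z.re < b) :
    ∃ M : ℝ, ∀ j, 1 ≤ j → j < p → ∀ z ∈ domC (expMap lam) p z₀ C j, |z.im| ≤ M := by
  have key : ∀ j, ∃ K : ℝ, 1 ≤ j → j < p → ∀ z ∈ domC (expMap lam) p z₀ C j, |z.im| ≤ K := by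
    intro j
    by_cases hj : 1 ≤ j ∧ j < p
    swap
    · exact ⟨0, fun h1 h2 => (hj ⟨h1, h2⟩).elim⟩
    obtain ⟨hj1, hjp⟩ := hj
    obtain ⟨i, hi⟩ : ∃ i, j + 1 + i = p := ⟨p - (j + 1), by omega⟩
    set P := (expMap lam)^[i] ⁻¹' rightDomain (expMap lam) p z₀ C b
    have hray : ∃ a u : ℂ, u ≠ 0 ∧ ∀ t : ℝ, 0 ≤ t → a + u * t ∈ P := by
      rcases Nat.eq_zero_or_pos i with rfl | hi0
      · refine ⟨((b + 1 : ℝ) : ℂ), 1, one_ne_zero, fun t ht => Or.inl ?_⟩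
        simp only [iterate_zero, id, mem_ofPred_eq, one_mul, Complex.add_re, Complex.ofReal_re]
        linarith
      · obtain ⟨i, rfl⟩ : ∃ i', i = i' + 1 := ⟨i - 1, by omega⟩
        obtain ⟨c, hc⟩ := exists_halfPlane_subset_preimage (lam := lam)
          (isOpen_preimage_rightDomain (b := b) h i)
          (zero_mem_preimage_rightDomain h (by omega))
        refine ⟨((c - 1 : ℝ) : ℂ), -1, by simp, fun t ht => hc ?_⟩
        simp only [mem_ofPred_eq, neg_mul, one_mul, Complex.add_re, Complex.ofReal_re,
          Complex.neg_re]
        linarith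
    obtain ⟨a, u, hu, hray⟩ := hray
    obtain ⟨K, hK⟩ := exists_im_bound_of_disjoint (lam := lam)
      (isOpen_preimage_rightDomain (b := b) h i)
      (isPreconnected_preimage_rightDomain hlam hcycle h (by omega))
      (zero_mem_preimage_rightDomain h (by omega)) hu hray
    refine ⟨K + |((expMap lam)^[j] z₀).im|, fun _ _ z hz => ?_⟩
    have h1 := hK _ (isPreconnected_domC h hjp.le)
      (fun z hz => notMem_preimage_rightDomain hcycle h hb hi (expMap_mem_domC hjp hz)) z hz _
      (iterate_mem_domC hcycle h hjp.le)
    have h2 := abs_sub_abs_le_abs_sub z.im ((expMap lam)^[j] z₀).im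
    linarith
  choose K hK using key
  refine ⟨∑ j ∈ Finset.range p, |K j|, fun j hj hjp z hz => ?_⟩
  refine (hK j hj hjp z hz).trans ((le_abs_self _).trans ?_)
  exact Finset.single_le_sum (f := fun j => |K j|) (fun _ _ => abs_nonneg _)
    (Finset.mem_range.2 hjp)

/-! ### The sets `H_s` -/

theorem add_int_mem_strip {f : ℂ → ℂ} {w z : ℂ} {s : ℤ} (hz : z ∈ strip f p z₀ C w s) (n : ℤ) :
    z + 2 * Real.pi * Complex.I * n ∈ strip f p z₀ C w (s + n) := by
  obtain ⟨y, hy, rfl⟩ := hz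
  exact ⟨y, hy, by push_cast; ring⟩

theorem add_int_mem_domC0_iff (z : ℂ) (n : ℤ) :
    z + 2 * Real.pi * Complex.I * n ∈ domC0 (expMap lam) p z₀ C ↔
      z ∈ domC0 (expMap lam) p z₀ C := by
  simp only [domC0, mem_preimage, expMap_add_int]

/-- Each H_s is a translate of a component of the complement of C_0, which is 2πi-periodic. -/
theorem subset_strip {T : Set ℂ} (hT : IsPreconnected T)
    (hTC : ∀ z ∈ T, z ∉ domC0 (expMap lam) p z₀ C) {w : ℂ} {s : ℤ} {x : ℂ} (hx : x ∈ T)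
    (hxs : x ∈ strip (expMap lam) p z₀ C w s) : T ⊆ strip (expMap lam) p z₀ C w s := by
  obtain ⟨y, hy, hyx⟩ := hxs
  set τ : ℂ → ℂ := fun z => z + 2 * Real.pi * Complex.I * ((-s : ℤ) : ℂ) with hτ
  have hτx : τ x = y := by
    simp only [hτ, ← hyx]
    push_cast
    ring
  have h1 : IsPreconnected (τ '' T) := hT.image _ (by fun_prop)
  have h2 : τ '' T ⊆ (domC0 (expMap lam) p z₀ C)ᶜ := by
    rintro _ ⟨z, hz, rfl⟩
    rw [mem_compl_iff, add_int_mem_domC0_iff]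
    exact hTC z hz
  have h3 := h1.subset_connectedComponentIn (x := y) ⟨x, hx, hτx⟩ h2
  rw [← connectedComponentIn_eq hy] at h3
  intro z hz
  exact ⟨τ z, h3 ⟨z, hz, rfl⟩, by simp only [hτ]; push_cast; ring⟩

end

/-! ### Iterated logarithms -/

/-- Compositions of branches of the inverse of the exponential map. -/
def logIter (d : ℕ → ℂ) : ℕ → ℂ → ℂ
  | 0, z => z
  | i + 1, z => Complex.log (logIter d i z) + d i

theorem logIter_congr {d d' : ℕ → ℂ} {i : ℕ} (h : ∀ l < i, d l = d' l) (z : ℂ) :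
    logIter d i z = logIter d' i z := by
  induction i with
  | zero => rfl
  | succ i ih => rw [logIter, logIter, ih (fun l hl => h l (by omega)), h i (by omega)]

/-- The bound depends only on the common real part of the constants `d i`, so M can be fixed before
they are chosen. -/
theorem exists_le_norm_logIter (a : ℝ) (p : ℕ) (R : ℝ) :
    ∃ M : ℝ, ∀ d : ℕ → ℂ, (∀ i, (d i).re = a) → ∀ z : ℂ, M ≤ ‖z‖ → ∀ i ≤ p,
      R ≤ ‖logIter d i z‖ ∧ (1 ≤ i → R ≤ (logIter d i z).re) := by
  induction p generalizing R with
  | zero =>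
    refine ⟨R, fun d _ z hz i hi => ?_⟩
    obtain rfl : i = 0 := by omega
    exact ⟨hz, by simp⟩
  | succ p ih =>
    obtain ⟨M, hM⟩ := ih (max R (Real.exp (R - a)))
    refine ⟨M, fun d hd z hz i hi => ?_⟩
    rcases hi.lt_or_eq with hi | rfl
    · obtain ⟨h1, h2⟩ := hM d hd z hz i (by omega)
      exact ⟨(le_max_left _ _).trans h1, fun h => (le_max_left _ _).trans (h2 h)⟩
    · have h1 := (le_max_right _ _).trans (hM d hd z hz p le_rfl).1
      have h2 : R ≤ (logIter d (p + 1) z).re := by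
        rw [logIter, Complex.add_re, Complex.log_re, hd]
        have := Real.log_le_log (Real.exp_pos _) h1
        rw [Real.log_exp] at this
        linarith
      exact ⟨h2.trans (Complex.re_le_norm _), fun _ => h2⟩

theorem expMap_log_add {lam c z : ℂ} (hc : lam * Complex.exp c = 1) (hz : z ≠ 0) :
    expMap lam (Complex.log z + c) = z := by
  rw [expMap, Complex.exp_add, Complex.exp_log hz, mul_left_comm, hc, mul_one]

theorem expMap_iterate_logIter {lam : ℂ} {d : ℕ → ℂ} (hd : ∀ i, lam * Complex.exp (d i) = 1)
    {z : ℂ} {i n : ℕ} (h : ∀ l < i + n, logIter d l z ≠ 0) :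
    (expMap lam)^[n] (logIter d (i + n) z) = logIter d i z := by
  induction n with
  | zero => rfl
  | succ n ih =>
    rw [iterate_succ_apply, ← add_assoc, logIter, expMap_log_add (hd _) (h _ (by omega)),
      ih (fun l hl => h l (by omega))]

theorem re_eq_of_mul_exp_eq_one {lam c : ℂ} (h : lam * Complex.exp c = 1) :
    c.re = -Real.log ‖lam‖ := by
  have h1 := congrArg norm h
  rw [norm_mul, Complex.norm_exp, norm_one] at h1
  have h2 : ‖lam‖ ≠ 0 := by rintro h0; rw [h0, zero_mul] at h1; exact zero_ne_one h1
  have h3 := congrArg Real.log h1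
  rw [Real.log_mul h2 (Real.exp_ne_zero _), Real.log_exp, Real.log_one] at h3
  linarith

theorem continuousOn_logIter {d : ℕ → ℂ} {S : Set ℂ} {i : ℕ}
    (h : ∀ l < i, ∀ z ∈ S, logIter d l z ∈ Complex.slitPlane) :
    ContinuousOn (logIter d i) S := by
  induction i with
  | zero => exact continuousOn_id
  | succ i ih =>
    exact ((ih fun l hl => h l (by omega)).clog (h i (by omega))).add continuousOn_const

/-! ### Inverse branches along the itinerary -/

section

variable {lam : ℂ} {p : ℕ} {z₀ : ℂ} {B C : Set ℂ}

/-- C_{p-n-1} maps onto C_{p-n}, so the current point has a preimage there; its difference from the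
principal logarithm is taken as `d n`. -/
theorem exists_logIter_mem_domC (hlam : lam ≠ 0)
    (hcycle : IsAttractingCycle (expMap lam) p z₀)
    (h : IsBasinConstruction (expMap lam) p z₀ B C) {q : ℂ} (hq : q ∈ C) {n : ℕ} (hn : n < p) :
    ∃ d : ℕ → ℂ, (∀ i, lam * Complex.exp (d i) = 1) ∧
      ∀ i ≤ n, logIter d i q ∈ domC (expMap lam) p z₀ C (p - i) := by
  induction n with
  | zero =>
    refine ⟨fun _ => -Complex.log lam, fun i => ?_, fun i hi => ?_⟩
    · rw [Complex.exp_neg, Complex.exp_log hlam, mul_inv_cancel₀ hlam]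
    · obtain rfl : i = 0 := by omega
      rw [Nat.sub_zero, domC_self]
      exact hq
  | succ n ih =>
    obtain ⟨d, hd, h1⟩ := ih (by omega)
    have h2 := h1 n le_rfl
    rw [show p - n = p - (n + 1) + 1 by omega,
      ← image_domC hlam hcycle h (by omega) (by omega)] at h2
    obtain ⟨y, hy, hyx⟩ := h2
    have hx0 : logIter d n q ≠ 0 := hyx ▸ expMap_ne_zero hlam y
    have hcongr : ∀ i ≤ n, logIter (update d n (y - Complex.log (logIter d n q))) i q =
        logIter d i q := fun i hi =>
      logIter_congr (fun l hl => update_of_ne (by omega) _ _) q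
    refine ⟨update d n (y - Complex.log (logIter d n q)), fun i => ?_, fun i hi => ?_⟩
    · by_cases hin : i = n
      · rw [hin, update_self, Complex.exp_sub, Complex.exp_log hx0, ← mul_div_assoc, ← expMap, hyx,
          div_self hx0]
      · rw [update_of_ne hin, hd]
    · rcases hi.lt_or_eq with hi | rfl
      · rw [hcongr i (by omega)]
        exact h1 i (by omega)
      · rw [logIter, hcongr n le_rfl, update_self, add_sub_cancel]
        exact hy

theorem exists_mem_strip_of_mem (hlam : lam ≠ 0) (hp : 1 < p)
    (hcycle : IsAttractingCycle (expMap lam) p z₀)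
    (h : IsBasinConstruction (expMap lam) p z₀ B C) {b : ℝ} (hb : ∀ z ∈ C, z.re < b)
    {w : ℂ} {M : ℝ} {c : ℂ} (hM : 0 ≤ M) (hc : lam * Complex.exp c = 1) {s : ℤ}
    (hstrip : ∀ z : ℂ, M < z.im → Complex.log z + c ∈ strip (expMap lam) p z₀ C w s) {x : ℂ}
    (hx : expMap lam x ∈ (expMap lam)^[p - 1] ⁻¹' rightDomain (expMap lam) p z₀ C b) :
    ∃ n : ℤ, x ∈ strip (expMap lam) p z₀ C w n := by
  set Q := (expMap lam)^[p - 1] ⁻¹' rightDomain (expMap lam) p z₀ C b with hQ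
  have hQC : ∀ z ∈ Q, z ∉ domC (expMap lam) p z₀ C 1 := fun z hz hz1 =>
    notMem_preimage_rightDomain hcycle h hb (by omega : 1 + (p - 1) = p) hz1 hz
  obtain ⟨i, hi⟩ : ∃ i, p - 1 = i + 1 := ⟨p - 2, by omega⟩
  obtain ⟨t, ht⟩ := exists_halfPlane_subset_preimage (lam := lam)
    (isOpen_preimage_rightDomain (b := b) h i) (zero_mem_preimage_rightDomain h (by omega))
  set v : ℂ := ⟨t - 1, M + 1⟩
  have hv : v ∈ Q := by
    rw [hQ, hi]
    exact ht (by simp [v])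
  -- Q is connected, omits 0 and contains points with Im z > M. The component of its preimage
  -- containing x avoids C_0 and covers v, so it meets a translate of a point already located by
  -- `hstrip`.
  have himage := image_component_eq hlam (isOpen_preimage_rightDomain (b := b) h (p - 1))
    (isPreconnected_preimage_rightDomain hlam hcycle h (by omega))
    (fun h0 => hQC 0 h0 (zero_mem_domC_one h)) hx
  rw [← hQ] at himage
  obtain ⟨u, hu, huv⟩ := himage.symm.subset hv
  have hMv : M < v.im := by simp [v]
  have hv0 : v ≠ 0 := by
    intro h0
    rw [h0, Complex.zero_im] at hMv
    exact hMv.not_ge hM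
  obtain ⟨n, hn⟩ := exists_int_of_expMap_eq hlam (huv.trans (expMap_log_add hc hv0).symm)
  have hus := add_int_mem_strip (hstrip v hMv) n
  rw [← hn] at hus
  refine ⟨s + n, subset_strip isPreconnected_connectedComponentIn (fun z hz hz0 => ?_) hu hus
    (mem_connectedComponentIn hx)⟩
  exact hQC _ (connectedComponentIn_subset _ _ hz : z ∈ expMap lam ⁻¹' Q) hz0

/-- The inverse branches of the iterates of the exponential map which realise the itineraries. -/
theorem exists_inverse_branches (hlam : lam ≠ 0) (hp : 1 < p)
    (hcycle : IsAttractingCycle (expMap lam) p z₀)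
    (h : IsBasinConstruction (expMap lam) p z₀ B C) {w : ℂ} {k : ℕ → ℤ}
    (hk : ∀ j : ℕ, 1 ≤ j → j < p →
      (expMap lam)^[j] z₀ ∈ strip (expMap lam) p z₀ C w (k j)) :
    ∃ (d : ℕ → ℂ) (M b : ℝ), (∀ i, lam * Complex.exp (d i) = 1) ∧
      (∀ z : ℂ, M < z.im → ∀ j, 1 ≤ j → j < p →
        logIter d (p - j) z ∈ strip (expMap lam) p z₀ C w (k j)) ∧
      ∀ z : ℂ, M < z.im → b < z.re → ∀ s : ℤ,
        logIter d p z + 2 * Real.pi * Complex.I * s ∈ strip (expMap lam) p z₀ C w s := by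
  obtain ⟨b, hb⟩ := exists_re_lt_of_mem hlam hp hcycle h
  obtain ⟨M₁, hM₁⟩ := exists_im_bound_domC hlam hcycle h hb
  obtain ⟨M₂, hM₂⟩ := exists_le_norm_logIter (-Real.log ‖lam‖) p 1
  set M := max (max M₁ M₂) 0
  have hM0 : 0 ≤ M := le_max_right _ _
  have hMM₁ : M₁ ≤ M := (le_max_left _ _).trans (le_max_left _ _)
  have hMM₂ : M₂ ≤ M := (le_max_right _ _).trans (le_max_left _ _)
  obtain ⟨t, ht⟩ := h.leftHalfPlane_C
  set q : ℂ := ⟨t - 1, M + 1⟩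
  have hqC : q ∈ C := ht (by simp [q])
  have hqM : M < q.im := by simp [q]
  have hlarge : ∀ d : ℕ → ℂ, (∀ i, lam * Complex.exp (d i) = 1) → ∀ z : ℂ, M < z.im → ∀ i ≤ p,
      1 ≤ ‖logIter d i z‖ ∧ (1 ≤ i → 1 ≤ (logIter d i z).re) := by
    intro d hd z hz
    refine hM₂ d (fun i => re_eq_of_mul_exp_eq_one (hd i)) z ?_
    exact hMM₂.trans (hz.le.trans ((le_abs_self _).trans (Complex.abs_im_le_norm z)))
  have hslit : ∀ d : ℕ → ℂ, (∀ i, lam * Complex.exp (d i) = 1) → ∀ i ≤ p,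
      ∀ z ∈ {z : ℂ | M < z.im}, logIter d i z ∈ Complex.slitPlane := by
    intro d hd i hi z hz
    rcases Nat.eq_zero_or_pos i with rfl | hi0
    · exact Or.inr (hM0.trans_lt hz).ne'
    · exact Or.inl (zero_lt_one.trans_le ((hlarge d hd z hz i hi).2 hi0))
  obtain ⟨d, hd, hdC⟩ := exists_logIter_mem_domC hlam hcycle h hqC (show p - 1 < p by omega)
  have hiter : ∀ z : ℂ, M < z.im → ∀ i ≤ p, (expMap lam)^[i] (logIter d i z) = z := by
    intro z hz i hi
    have := expMap_iterate_logIter hd (z := z) (i := 0) (n := i)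
      (fun l hl => Complex.slitPlane_ne_zero (hslit d hd l (by omega) z hz))
    rwa [zero_add] at this
  have hmain : ∀ z : ℂ, M < z.im → ∀ j, 1 ≤ j → j < p →
      logIter d (p - j) z ∈ strip (expMap lam) p z₀ C w (k j) := by
    intro z hz j hj hjp
    set E := logIter d (p - j) '' {z : ℂ | M < z.im}
    have hE : IsPreconnected E := (convex_halfSpace_im_gt M).isPreconnected.image _
      (continuousOn_logIter fun l hl => hslit d hd l (by omega))
    have hq : logIter d (p - j) q ∈ domC (expMap lam) p z₀ C j := by
      have := hdC (p - j) (by omega)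
      rwa [show p - (p - j) = j by omega] at this
    -- A point of E in C_0 would map forward into C_{p-j}, contradicting the bound on imaginary
    -- parts there.
    have hEC : ∀ x ∈ E, x ∉ domC0 (expMap lam) p z₀ C := by
      rintro _ ⟨y, hy, rfl⟩ h0
      have h1 : expMap lam (logIter d (p - j) y) ∈ domC (expMap lam) p z₀ C 1 := h0
      have h2 := expMap_iterate_mem_domC (i := p - j - 1) (by omega) h1
      rw [← iterate_succ_apply, show (p - j - 1).succ = p - j by omega,
        hiter y hy _ (by omega)] at h2
      have h3 := hM₁ _ (by omega) (by omega) y h2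
      exact (hMM₁.trans_lt (hy.trans_le (le_abs_self _))).not_ge h3
    have hunion := subset_strip (hE.union (logIter d (p - j) q) (mem_image_of_mem _ hqM) hq (isPreconnected_domC h hjp.le))
      (fun x hx => hx.elim (hEC x) (notMem_domC0 hcycle h hj hjp))
      (Or.inr (iterate_mem_domC hcycle h hjp.le)) (hk j hj hjp)
    exact hunion (Or.inl ⟨z, hz, rfl⟩)
  set D := {z : ℂ | M < z.im} ∩ {z : ℂ | b < z.re}
  set z₁ : ℂ := ⟨b + 1, M + 1⟩
  have hz₁ : z₁ ∈ D := ⟨by simp [z₁], by simp [z₁]⟩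
  have hDQ : ∀ z ∈ D, expMap lam (logIter d p z) ∈
      (expMap lam)^[p - 1] ⁻¹' rightDomain (expMap lam) p z₀ C b := by
    intro z hz
    rw [mem_preimage, ← iterate_succ_apply, show (p - 1).succ = p by omega,
      hiter z hz.1 p le_rfl]
    exact Or.inl hz.2
  obtain ⟨n, hn⟩ := exists_mem_strip_of_mem hlam hp hcycle h hb hM0 (hd 0)
    (s := k (p - 1)) (w := w) (fun z hz => by
      have := hmain z hz (p - 1) (by omega) (by omega)
      rwa [show p - (p - 1) = 0 + 1 by omega] at this) (hDQ z₁ hz₁)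
  have hsub : logIter d p '' D ⊆ strip (expMap lam) p z₀ C w n := by
    refine subset_strip (IsPreconnected.image ?_ _ ?_) ?_ ⟨z₁, hz₁, rfl⟩ hn
    · exact ((convex_halfSpace_im_gt M).inter (convex_halfSpace_re_gt b)).isPreconnected
    · exact (continuousOn_logIter fun l hl => hslit d hd l (by omega)).mono inter_subset_left
    · rintro _ ⟨z, hz, rfl⟩ h0
      exact notMem_preimage_rightDomain hcycle h hb (by omega : 1 + (p - 1) = p) h0 (hDQ z hz)
  -- Only the last constant is shifted, by -2πin, so that the quadrant lands in H_0 and the earlier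
  -- levels are unchanged.
  set d' := update d (p - 1) (d (p - 1) + 2 * Real.pi * Complex.I * ((-n : ℤ) : ℂ)) with hd'
  have hcongr : ∀ i ≤ p - 1, ∀ z, logIter d' i z = logIter d i z := fun i hi z =>
    logIter_congr (fun l hl => update_of_ne (by omega) _ _) z
  refine ⟨d', M, b, fun i => ?_, fun z hz j hj hjp => ?_, fun z hz hbz s => ?_⟩
  · by_cases hi : i = p - 1
    · rw [hi, hd', update_self]
      exact (expMap_add_int lam _ _).trans (hd _)
    · rw [hd', update_of_ne hi, hd]
  · rw [hcongr _ (by omega)]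
    exact hmain z hz j hj hjp
  · have h1 := add_int_mem_strip (hsub ⟨z, ⟨hz, hbz⟩, rfl⟩) (s - n)
    have h2 : logIter d' p z = logIter d p z + 2 * Real.pi * Complex.I * ((-n : ℤ) : ℂ) := by
      obtain ⟨r, hr⟩ : ∃ r, p = r + 1 := ⟨p - 1, by omega⟩
      have h3 := hcongr r (by omega) z
      have h4 : d' r = d r + 2 * Real.pi * Complex.I * ((-n : ℤ) : ℂ) := by
        rw [hd', hr, Nat.add_sub_cancel, update_self]
      rw [hr, logIter, logIter, h3, h4, add_assoc]
    rw [add_sub_cancel] at h1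
    convert h1 using 1
    rw [h2]
    push_cast
    ring

end

/-! ### Iterated function systems and their coding maps -/

/-- The sequence with first entry `i` followed by the entries of `ω`. -/
def consSeq {ι : Type*} (i : ι) (ω : ℕ → ι) : ℕ → ι
  | 0 => i
  | n + 1 => ω n

/-- The coding map of a contracting iterated function system. -/
theorem exists_coding {ι Y : Type*} [TopologicalSpace ι] [DiscreteTopology ι] [Finite ι]
    [MetricSpace Y] [CompleteSpace Y] [Nonempty Y] (F : ι → Y → Y)
    (hF : ∀ i, ∀ x y, dist (F i x) (F i y) ≤ 2⁻¹ * dist x y) :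
    ∃ κ : C(ℕ → ι, Y), ∀ ω, κ ω = F (ω 0) (κ fun n => ω (n + 1)) := by
  have hFc : Continuous fun q : ι × Y => F q.1 q.2 := by
    rw [continuous_prod_of_discrete_left]
    intro i
    exact (LipschitzWith.of_dist_le_mul (K := 2⁻¹) (by simpa using hF i)).continuous
  let Θ : C(ℕ → ι, Y) → C(ℕ → ι, Y) := fun u =>
    ⟨fun ω => F (ω 0) (u fun n => ω (n + 1)),
      hFc.comp (f := fun ω : ℕ → ι => (ω 0, u fun n => ω (n + 1)))
        ((continuous_apply 0).prodMk
          (u.continuous.comp (continuous_pi fun n => continuous_apply (n + 1))))⟩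
  have hΘ : ContractingWith 2⁻¹ Θ := by
    refine ⟨by norm_num, LipschitzWith.of_dist_le_mul fun u v => ?_⟩
    rw [ContinuousMap.dist_le (by positivity)]
    intro ω
    refine (hF _ _ _).trans ?_
    simpa using ContinuousMap.dist_apply_le_dist (f := u) (g := v) (fun n => ω (n + 1))
  have : Nonempty C(ℕ → ι, Y) := ⟨ContinuousMap.const _ (Classical.arbitrary Y)⟩
  refine ⟨ContractingWith.fixedPoint Θ hΘ, fun ω => ?_⟩
  have := hΘ.fixedPoint_isFixedPt
  exact (DFunLike.congr_fun this ω).symm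

/-- Pairs with different first digits form a compact set on which the distance is positive. -/
theorem exists_separation {ι Y : Type*} [TopologicalSpace ι] [DiscreteTopology ι] [Finite ι]
    [MetricSpace Y] (κ : C(ℕ → ι, Y)) (hκ : Injective κ) :
    ∃ δ > 0, ∀ ω ω' : ℕ → ι, ω 0 ≠ ω' 0 → δ ≤ dist (κ ω) (κ ω') := by
  have hcl : IsClosed {q : (ℕ → ι) × (ℕ → ι) | q.1 0 ≠ q.2 0} :=
    (isClosed_discrete {q : ι × ι | q.1 ≠ q.2}).preimage
      (f := fun q : (ℕ → ι) × (ℕ → ι) => (q.1 0, q.2 0)) (by fun_prop)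
  obtain ⟨δ, hδ, h⟩ := hcl.isCompact.exists_forall_le' (a := (0 : ℝ))
    (f := fun q : (ℕ → ι) × (ℕ → ι) => dist (κ q.1) (κ q.2)) (by fun_prop)
    (fun q hq => dist_pos.2 fun h => hq (congrFun (hκ h) 0))
  exact ⟨δ, hδ, fun ω ω' hω => h (ω, ω') hω⟩

theorem isCantorSet_range {m : ℕ} (hm : 2 ≤ m) (κ : C(ℕ → Fin m, ℂ)) (hκ : Injective κ) :
    IsCantorSet (range κ) := by
  have hcpt : IsCompact (range κ) := isCompact_range κ.continuous
  have : Nontrivial (Fin m) := Fin.nontrivial_iff_two_le.2 hm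
  have : Nonempty (Fin m) := ⟨⟨0, by omega⟩⟩
  refine ⟨range_nonempty κ, hcpt, ⟨hcpt.isClosed, ?_⟩, ?_⟩
  · rintro _ ⟨ω, rfl⟩
    rw [accPt_iff_frequently]
    choose o ho using fun i : Fin m => exists_ne i
    have hlim : Tendsto (fun n : ℕ => update ω n (o (ω n))) atTop (𝓝 ω) := by
      rw [tendsto_pi_nhds]
      intro l
      refine tendsto_const_nhds.congr' ?_
      filter_upwards [eventually_gt_atTop l] with n hn
      rw [update_of_ne hn.ne]
    refine ((κ.continuous.tendsto ω).comp hlim).frequently (Frequently.of_forall fun n => ?_)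
    refine ⟨fun h => ?_, mem_range_self _⟩
    have := congrFun (hκ h) n
    exact ho _ ((update_self n (o (ω n)) ω).symm.trans this)
  · have hemb : IsEmbedding κ := (κ.continuous.isClosedEmbedding hκ).isEmbedding
    exact hemb.isTotallyDisconnected_range.2 inferInstance

/-! ### A lower bound for the dimension of self-similar-like sets -/

theorem exists_digit {q : ℕ → ℝ} {m : ℕ} (hsum : ∑ i ∈ Finset.range m, q i = 1) {t : ℝ}
    (ht : t ∈ Ico (0 : ℝ) 1) :
    ∃ i : Fin m, ∑ j ∈ Finset.range i, q j ≤ t ∧ t < ∑ j ∈ Finset.range i, q j + q i := by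
  classical
  have hex : ∃ n, t < ∑ j ∈ Finset.range n, q j := ⟨m, hsum ▸ ht.2⟩
  have hn := Nat.find_spec hex
  have hle : Nat.find hex ≤ m := Nat.find_min' hex (hsum ▸ ht.2)
  obtain ⟨i, hi⟩ : ∃ i, Nat.find hex = i + 1 := by
    refine Nat.exists_eq_succ_of_ne_zero fun h0 => ?_
    rw [h0, Finset.range_zero, Finset.sum_empty] at hn
    exact hn.not_ge ht.1
  refine ⟨⟨i, by omega⟩, ?_, ?_⟩
  · exact not_lt.1 (Nat.find_min hex (show i < Nat.find hex by omega))
  · rw [hi, Finset.sum_range_succ] at hn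
    exact hn

/-- If the maps of an iterated function system expand distances at least by the factors `c i` and
the first level pieces are separated, then the dimension of the limit set is at least any `σ`
with `∑ c i ^ σ ≥ 1`. -/
theorem le_dimH_range_coding {E : Type*} [MetricSpace E] {m : ℕ} {c : ℕ → ℝ} {σ : NNReal}
    (hσ : 0 < σ) (hc0 : ∀ i < m, 0 < c i) (hc1 : ∀ i < m, c i ≤ 1 / 2)
    (hsum : 1 ≤ ∑ i ∈ Finset.range m, c i ^ (σ : ℝ)) (κ : (ℕ → Fin m) → E) {δ : ℝ} (hδ : 0 < δ)
    (hsep : ∀ ω ω' : ℕ → Fin m, ω 0 ≠ ω' 0 → δ ≤ dist (κ ω) (κ ω'))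
    (hκ : ∀ i : Fin m, ∀ ω ω' : ℕ → Fin m,
      c i * dist (κ ω) (κ ω') ≤ dist (κ (consSeq i ω)) (κ (consSeq i ω'))) :
    (σ : ENNReal) ≤ dimH (range κ) := by
  have hσ' : (0 : ℝ) < σ := hσ
  set A := ∑ i ∈ Finset.range m, c i ^ (σ : ℝ)
  have hA : 0 < A := zero_lt_one.trans_le hsum
  -- Probability weights: [0,1) is cut into intervals of lengths `q i`, and iterating the expanding
  -- map `T` gives each t a word `e t`.
  set q : ℕ → ℝ := fun i => c i ^ (σ : ℝ) / A
  have hq0 : ∀ i < m, 0 < q i := fun i hi => div_pos (Real.rpow_pos_of_pos (hc0 i hi) _) hA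
  have hqc : ∀ i < m, q i ≤ c i ^ (σ : ℝ) := fun i hi =>
    div_le_self (Real.rpow_nonneg (hc0 i hi).le _) hsum
  set ρ : ℝ := (1 / 2) ^ (σ : ℝ)
  have hρ0 : 0 ≤ ρ := by positivity
  have hρ1 : ρ < 1 := Real.rpow_lt_one (by norm_num) (by norm_num) hσ'
  have hqρ : ∀ i < m, q i ≤ ρ := fun i hi =>
    (hqc i hi).trans (Real.rpow_le_rpow (hc0 i hi).le (hc1 i hi) hσ'.le)
  have hqsum : ∑ i ∈ Finset.range m, q i = 1 := by
    rw [← Finset.sum_div, div_self hA.ne']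
  choose dg hdg1 hdg2 using fun t : Ico (0 : ℝ) 1 => exists_digit hqsum t.2
  let T : Ico (0 : ℝ) 1 → Ico (0 : ℝ) 1 := fun t =>
    ⟨(t - ∑ j ∈ Finset.range (dg t), q j) / q (dg t),
      div_nonneg (sub_nonneg.2 (hdg1 t)) (hq0 _ (dg t).2).le,
      (div_lt_one (hq0 _ (dg t).2)).2 (by linarith [hdg2 t])⟩
  have hT : ∀ t : Ico (0 : ℝ) 1, (t : ℝ) = ∑ j ∈ Finset.range (dg t), q j + q (dg t) * T t := by
    intro t
    have := (hq0 _ (dg t).2).ne'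
    simp only [T]
    field_simp
    ring
  let e : Ico (0 : ℝ) 1 → ℕ → Fin m := fun t n => dg (T^[n] t)
  have he : ∀ t, e t = consSeq (dg t) (e (T t)) := by
    intro t
    funext n
    cases n with
    | zero => rfl
    | succ n => simp only [e, consSeq, iterate_succ_apply]
  let x : Ico (0 : ℝ) 1 → E := fun t => κ (e t)
  set K : ℝ := (δ ^ (σ : ℝ))⁻¹
  have hK : 0 < K := inv_pos.2 (Real.rpow_pos_of_pos hδ _)
  -- A common first digit rescales both sides, as `q i` ≤ `c i`^σ; different first digits are
  -- handled by the separation δ. The error ρ^n disappears as n → ∞.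
  have key : ∀ n : ℕ, ∀ t t' : Ico (0 : ℝ) 1,
      |(t : ℝ) - t'| ≤ max (K * dist (x t) (x t') ^ (σ : ℝ)) (ρ ^ n) := by
    intro n
    induction n with
    | zero =>
      intro t t'
      refine le_max_of_le_right ?_
      rw [pow_zero, abs_le]
      constructor <;> linarith [t.2.1, t.2.2, t'.2.1, t'.2.2]
    | succ n ih =>
      intro t t'
      by_cases hd : dg t = dg t'
      · have h1 : (t : ℝ) - t' = q (dg t) * ((T t : ℝ) - T t') := by
          rw [hT t, hT t', hd]
          ring
        rw [h1, abs_mul, abs_of_pos (hq0 _ (dg t).2)]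
        refine (mul_le_mul_of_nonneg_left (ih (T t) (T t')) (hq0 _ (dg t).2).le).trans ?_
        rw [mul_max_of_nonneg _ _ (hq0 _ (dg t).2).le]
        refine max_le_max ?_ ?_
        · have h2 := hκ (dg t) (e (T t)) (e (T t'))
          rw [← he t, hd, ← he t', ← hd] at h2
          calc q (dg t) * (K * dist (x (T t)) (x (T t')) ^ (σ : ℝ))
              ≤ c (dg t) ^ (σ : ℝ) * (K * dist (x (T t)) (x (T t')) ^ (σ : ℝ)) :=
                mul_le_mul_of_nonneg_right (hqc _ (dg t).2) (by positivity)
            _ = K * (c (dg t) * dist (x (T t)) (x (T t'))) ^ (σ : ℝ) := by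
                rw [Real.mul_rpow (hc0 _ (dg t).2).le dist_nonneg]
                ring
            _ ≤ K * dist (x t) (x t') ^ (σ : ℝ) := by
                refine mul_le_mul_of_nonneg_left (Real.rpow_le_rpow ?_ h2 hσ'.le) hK.le
                exact mul_nonneg (hc0 _ (dg t).2).le dist_nonneg
        · rw [pow_succ']
          exact mul_le_mul_of_nonneg_right (hqρ _ (dg t).2) (by positivity)
      · refine le_max_of_le_left ?_
        have h1 : δ ≤ dist (x t) (x t') := hsep _ _ hd
        have h2 : (1 : ℝ) ≤ K * dist (x t) (x t') ^ (σ : ℝ) := by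
          rw [← inv_mul_cancel₀ (Real.rpow_pos_of_pos hδ (σ : ℝ)).ne']
          exact mul_le_mul_of_nonneg_left (Real.rpow_le_rpow hδ.le h1 hσ'.le) hK.le
        refine le_trans ?_ h2
        rw [abs_le]
        constructor <;> linarith [t.2.1, t.2.2, t'.2.1, t'.2.2]
  have hholder : ∀ t t' : Ico (0 : ℝ) 1, |(t : ℝ) - t'| ≤ K * dist (x t) (x t') ^ (σ : ℝ) := by
    intro t t'
    by_contra! hlt
    have h1 : ∀ n : ℕ, |(t : ℝ) - t'| ≤ ρ ^ n := fun n =>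
      (le_max_iff.1 (key n t t')).resolve_left hlt.not_ge
    have h2 := ge_of_tendsto' (tendsto_pow_atTop_nhds_zero_of_lt_one hρ0 hρ1) h1
    have h3 : 0 ≤ K * dist (x t) (x t') ^ (σ : ℝ) := by positivity
    linarith
  have hinj : Injective x := by
    intro t t' h
    have := hholder t t'
    rw [h, dist_self, Real.zero_rpow hσ'.ne', mul_zero] at this
    exact Subtype.ext (sub_eq_zero.1 (abs_eq_zero.1 (le_antisymm this (abs_nonneg _))))
  -- The inverse of x is σ-Hölder from the coded points onto [0,1), so 1 ≤ dim/σ. Its values off the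
  -- range of x play no role.
  set φ : E → ℝ := extend x Subtype.val 0
  have hφ : ∀ t, φ (x t) = t := fun t => hinj.extend_apply _ _ t
  have hH : HolderOnWith K.toNNReal σ φ (range x) := by
    rintro _ ⟨t, rfl⟩ _ ⟨t', rfl⟩
    rw [hφ, hφ, edist_dist, edist_dist, ENNReal.ofReal_rpow_of_nonneg dist_nonneg hσ'.le]
    change _ ≤ ENNReal.ofReal K * _
    rw [← ENNReal.ofReal_mul hK.le]
    exact ENNReal.ofReal_le_ofReal (hholder t t')
  have himg : φ '' range x = Ico 0 1 := by
    rw [← range_comp]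
    have : φ ∘ x = Subtype.val := funext hφ
    rw [this, Subtype.range_coe]
  have h1 := hH.dimH_image_le hσ
  have h2 : dimH (Ico (0 : ℝ) 1) = 1 := by
    rw [Real.dimH_of_nonempty_interior (by rw [interior_Ico]; exact nonempty_Ioo.2 one_pos)]
    simp
  rw [himg, h2, ENNReal.le_div_iff_mul_le (by simp [hσ.ne']) (by simp), one_mul] at h1
  refine h1.trans (dimH_mono ?_)
  rintro _ ⟨t, rfl⟩
  exact mem_range_self _

/-- The strict inequality at exponent 1 persists for some σ > 1 by continuity. -/
theorem one_lt_dimH_range_coding {E : Type*} [MetricSpace E] {m : ℕ} {c : ℕ → ℝ}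
    (hc0 : ∀ i < m, 0 < c i) (hc1 : ∀ i < m, c i ≤ 1 / 2)
    (hsum : 1 < ∑ i ∈ Finset.range m, c i) (κ : C(ℕ → Fin m, E)) (hκi : Injective κ)
    (hκ : ∀ i : Fin m, ∀ ω ω' : ℕ → Fin m,
      c i * dist (κ ω) (κ ω') ≤ dist (κ (consSeq i ω)) (κ (consSeq i ω'))) :
    1 < dimH (range κ) := by
  obtain ⟨δ, hδ, hsep⟩ := exists_separation κ hκi
  have hcont : ContinuousAt (fun σ : ℝ => ∑ i ∈ Finset.range m, c i ^ σ) 1 := by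
    refine tendsto_finsetSum _ fun i hi => ?_
    exact Real.continuousAt_const_rpow (hc0 i (Finset.mem_range.1 hi)).ne'
  have h1 : ∀ᶠ σ : ℝ in 𝓝 1, 1 < ∑ i ∈ Finset.range m, c i ^ σ :=
    hcont.eventually_const_lt (by simpa using hsum)
  obtain ⟨σ, hσ, hσ1⟩ := ((h1.filter_mono nhdsWithin_le_nhds).and
    (self_mem_nhdsWithin : Ioi (1 : ℝ) ∈ 𝓝[>] 1)).exists
  have hσ0 : (0 : ℝ) < σ := zero_lt_one.trans hσ1
  refine lt_of_lt_of_le ?_ (le_dimH_range_coding (σ := ⟨σ, hσ0.le⟩) hσ0 hc0 hc1 hσ.le κ hδ hsep hκ)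
  exact ENNReal.coe_lt_coe.2 (show (1 : NNReal) < ⟨σ, hσ0.le⟩ from hσ1)

/-! ### Estimates for logarithms -/

/-- exp is r-Lipschitz on Re u ≤ log r; working with exp avoids the branch cut. -/
theorem norm_sub_le_mul_norm_log_sub {r : ℝ} {z w : ℂ} (hz : z ≠ 0) (hw : w ≠ 0) (hzr : ‖z‖ ≤ r)
    (hwr : ‖w‖ ≤ r) : ‖z - w‖ ≤ r * ‖Complex.log z - Complex.log w‖ := by
  have hr : 0 < r := (norm_pos_iff.2 hz).trans_le hzr
  have hmem : ∀ u : ℂ, u ≠ 0 → ‖u‖ ≤ r → Complex.log u ∈ {u : ℂ | u.re ≤ Real.log r} :=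
    fun u hu hur => by
      rw [mem_ofPred_eq, Complex.log_re]
      exact Real.log_le_log (norm_pos_iff.2 hu) hur
  have := (convex_halfSpace_re_le (Real.log r)).norm_image_sub_le_of_norm_deriv_le
    (f := Complex.exp) (C := r) (fun u _ => Complex.differentiableAt_exp)
    (fun u hu => by
      rw [Complex.deriv_exp, Complex.norm_exp, ← Real.le_log_iff_exp_le hr]
      exact hu) (hmem w hw hwr) (hmem z hz hzr)
  rwa [Complex.exp_log hz, Complex.exp_log hw] at this

theorem norm_log_sub_le {S : Set ℂ} (hS : Convex ℝ S) (hslit : S ⊆ Complex.slitPlane) {R : ℝ}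
    (hR : 0 < R) (hSR : ∀ z ∈ S, R ≤ ‖z‖) {z w : ℂ} (hz : z ∈ S) (hw : w ∈ S) :
    ‖Complex.log z - Complex.log w‖ ≤ R⁻¹ * ‖z - w‖ := by
  refine hS.norm_image_sub_le_of_norm_deriv_le (f := Complex.log)
    (fun u hu => Complex.differentiableAt_log (hslit hu)) (fun u hu => ?_) hw hz
  rw [(Complex.hasDerivAt_log (hslit hu)).deriv, norm_inv]
  exact inv_anti₀ hR (hSR u hu)

theorem norm_log_le {z : ℂ} (hz : 1 ≤ ‖z‖) : ‖Complex.log z‖ ≤ Real.log ‖z‖ + Real.pi := by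
  refine (Complex.norm_le_abs_re_add_abs_im _).trans (add_le_add ?_ ?_)
  · rw [Complex.log_re, abs_of_nonneg (Real.log_nonneg hz)]
  · rw [Complex.log_im]
    exact Complex.abs_arg_le_pi z

/-- The map `x ↦ log x + K`, whose iterates bound those of branches of the logarithm. -/
def shiftedLog (K x : ℝ) : ℝ := Real.log x + K

theorem one_le_shiftedLog_iterate {K : ℝ} (hK : 1 ≤ K) (n : ℕ) {x : ℝ} (hx : 1 ≤ x) :
    1 ≤ (shiftedLog K)^[n] x := by
  induction n with
  | zero => exact hx
  | succ n ih =>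
    rw [iterate_succ_apply', shiftedLog]
    linarith [Real.log_nonneg ih]

/-- The tangent-line inequality for the concave function L^n, whose derivative at x is the
reciprocal of the product. -/
theorem shiftedLog_iterate_sub_le {K : ℝ} (hK : 1 ≤ K) (n : ℕ) {x y : ℝ} (hx : 1 ≤ x)
    (hxy : x ≤ y) : (shiftedLog K)^[n] x ≤ (shiftedLog K)^[n] y ∧
      (∏ j ∈ Finset.range n, (shiftedLog K)^[j] x) *
        ((shiftedLog K)^[n] y - (shiftedLog K)^[n] x) ≤ y - x := by
  induction n with
  | zero => simpa using hxy
  | succ n ih =>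
    obtain ⟨h1, h2⟩ := ih
    have hu : 1 ≤ (shiftedLog K)^[n] x := one_le_shiftedLog_iterate hK n hx
    have hP : 0 ≤ ∏ j ∈ Finset.range n, (shiftedLog K)^[j] x := Finset.prod_nonneg fun j _ =>
      zero_le_one.trans (one_le_shiftedLog_iterate hK j hx)
    rw [iterate_succ_apply', iterate_succ_apply', Finset.prod_range_succ]
    set u := (shiftedLog K)^[n] x
    set v := (shiftedLog K)^[n] y
    have hu0 : 0 < u := zero_lt_one.trans_le hu
    have hv0 : 0 < v := hu0.trans_le h1
    have hlog : Real.log v - Real.log u ≤ v / u - 1 := by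
      rw [← Real.log_div hv0.ne' hu0.ne']
      exact Real.log_le_sub_one_of_pos (div_pos hv0 hu0)
    simp only [shiftedLog]
    refine ⟨by linarith [Real.log_le_log hu0 h1], le_trans ?_ h2⟩
    rw [mul_assoc]
    refine mul_le_mul_of_nonneg_left ?_ hP
    calc u * (Real.log v + K - (Real.log u + K)) = u * (Real.log v - Real.log u) := by ring
      _ ≤ u * (v / u - 1) := mul_le_mul_of_nonneg_left hlog hu0.le
      _ = v - u := by field_simp

theorem shiftedLog_iterate_le {K : ℝ} (hK : 1 ≤ K) (n : ℕ) {x : ℝ} (hx : 1 ≤ x) :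
    (shiftedLog K)^[n + 1] x ≤ Real.log x + (n + 1) * K := by
  induction n with
  | zero => simp [shiftedLog]
  | succ n ih =>
    have h1 := one_le_shiftedLog_iterate hK (n + 1) hx
    rw [iterate_succ_apply', shiftedLog]
    have := Real.log_le_sub_one_of_pos (zero_lt_one.trans_le h1)
    push_cast
    linarith

theorem tendsto_shiftedLog_iterate (K : ℝ) (n : ℕ) :
    Tendsto (shiftedLog K)^[n] atTop atTop := by
  induction n with
  | zero => exact tendsto_id
  | succ n ih =>
    rw [iterate_succ']
    exact (tendsto_atTop_add_const_right _ K Real.tendsto_log_atTop).comp ih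

/-- The sum of the reciprocals of the products of the iterated logarithms diverges, with control on
the size of the last term in terms of the first index. -/
theorem exists_shiftedLog_sum {K : ℝ} (hK : 1 ≤ K) {p : ℕ} (hp : 1 ≤ p) (N₀ : ℕ) :
    ∃ N m : ℕ, N₀ ≤ N ∧ 1 ≤ N ∧ (shiftedLog K)^[p] (8 * (N + m)) ≤ N ∧
      1 < ∑ i ∈ Finset.range m, (∏ j ∈ Finset.range p, (shiftedLog K)^[j] (8 * (N + i)))⁻¹ := by
  obtain ⟨r, rfl⟩ : ∃ r, p = r + 1 := ⟨p - 1, by omega⟩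
  set L := shiftedLog K with hL
  -- With slope 1/16, L^p(8N) ≤ N/2 + a, which leaves about half of t after telescoping.
  have hlog : ∀ x : ℝ, 0 < x → Real.log x ≤ x / 16 + Real.log 16 := by
    intro x hx
    have := Real.log_le_sub_one_of_pos (show 0 < x / 16 by positivity)
    rw [Real.log_div hx.ne' (by norm_num)] at this
    linarith
  set a : ℝ := Real.log 16 + (r + 1) * K
  have hbound : ∀ x : ℝ, 1 ≤ x → L^[r + 1] x ≤ x / 16 + a := by
    intro x hx
    have h1 := shiftedLog_iterate_le hK r hx
    have h2 := hlog x (by linarith)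
    linarith
  have htend : Tendsto (fun n : ℕ => L^[r + 1] (8 * (n : ℝ))) atTop atTop :=
    (tendsto_shiftedLog_iterate K (r + 1)).comp
      (tendsto_natCast_atTop_atTop.const_mul_atTop (by norm_num : (0 : ℝ) < 8))
  obtain ⟨n, hn1, hn2, hn3⟩ := ((htend.eventually_ge_atTop (2 * (a + 9) + N₀)).and
    ((tendsto_natCast_atTop_atTop.eventually_ge_atTop (2 * (a + 1))).and
      (eventually_ge_atTop 1))).exists
  have ha0 : 0 ≤ a := by
    have : 0 ≤ Real.log 16 := Real.log_nonneg (by norm_num)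
    positivity
  set t := L^[r + 1] (8 * (n : ℝ)) with ht
  have ht0 : 0 ≤ t := by have : (0 : ℝ) ≤ N₀ := N₀.cast_nonneg; linarith
  have hn3' : (1 : ℝ) ≤ n := by exact_mod_cast hn3
  -- The sum n = N + m is fixed first; then N ≥ t = L^p(8(N + m)) is automatic. The telescoped sum
  -- is at least (t - L^p(8N))/8, and this exceeds 1.
  set N := ⌈t⌉₊
  have hN1 : t ≤ N := Nat.le_ceil t
  have hN2 : (N : ℝ) < t + 1 := Nat.ceil_lt_add_one ht0
  have hNn : N ≤ n := by
    have h1 := hbound (8 * n) (by linarith)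
    have : (N : ℝ) < n + 1 := by rw [← ht] at h1; linarith
    exact Nat.lt_add_one_iff.1 (by exact_mod_cast this)
  have hN₀ : N₀ ≤ N := by
    have : (N₀ : ℝ) ≤ N := by linarith
    exact_mod_cast this
  have hNone : 1 ≤ N := by
    have : (1 : ℝ) ≤ N := by have : (0 : ℝ) ≤ N₀ := N₀.cast_nonneg; linarith
    exact_mod_cast this
  obtain ⟨m, hm⟩ : ∃ m, n = N + m := ⟨n - N, by omega⟩
  have hm' : (n : ℝ) = N + m := by rw [hm, Nat.cast_add]
  rw [hm'] at ht
  refine ⟨N, m, hN₀, hNone, ht ▸ hN1, ?_⟩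
  have hNone' : (1 : ℝ) ≤ N := by exact_mod_cast hNone
  have hterm : ∀ i : ℕ, L^[r + 1] (8 * (N + (i + 1 : ℕ))) - L^[r + 1] (8 * (N + i)) ≤
      8 * (∏ j ∈ Finset.range (r + 1), L^[j] (8 * (N + i)))⁻¹ := by
    intro i
    have hi : (0 : ℝ) ≤ i := i.cast_nonneg
    have hx : (1 : ℝ) ≤ 8 * (N + i) := by linarith
    have h1 := (shiftedLog_iterate_sub_le hK (r + 1) hx
      (show (8 * (N + i) : ℝ) ≤ 8 * (N + (i + 1 : ℕ)) by push_cast; linarith)).2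
    have hP : 0 < ∏ j ∈ Finset.range (r + 1), (shiftedLog K)^[j] (8 * (N + i)) :=
      Finset.prod_pos fun j _ => zero_lt_one.trans_le (one_le_shiftedLog_iterate hK j hx)
    rw [← div_eq_mul_inv, le_div_iff₀ hP, mul_comm]
    refine h1.trans (le_of_eq ?_)
    push_cast
    ring
  have hsum := Finset.sum_le_sum fun i (_ : i ∈ Finset.range m) => hterm i
  rw [Finset.sum_range_sub (fun i : ℕ => L^[r + 1] (8 * ((N : ℝ) + i))), ← Finset.mul_sum] at hsum
  have hlast := hbound (8 * N) (by linarith)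
  rw [← ht] at hsum
  simp only [Nat.cast_zero, add_zero] at hsum
  linarith

/-! ### Upper and lower distance bounds for iterated logarithms -/

theorem norm_logIter_le {d : ℕ → ℂ} {K r : ℝ} {p : ℕ} (hK : ∀ i < p, Real.pi + ‖d i‖ ≤ K) {z : ℂ}
    (hz : ‖z‖ ≤ r) (h1 : ∀ l < p, 1 ≤ ‖logIter d l z‖) {i : ℕ} (hi : i ≤ p) :
    ‖logIter d i z‖ ≤ (shiftedLog K)^[i] r := by
  induction i with
  | zero => exact hz
  | succ i ih =>
    rw [iterate_succ_apply', shiftedLog, logIter]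
    have h2 := h1 i (by omega)
    have h3 := norm_log_le h2
    have h4 := Real.log_le_log (by linarith) (ih (by omega))
    have h5 := norm_add_le (Complex.log (logIter d i z)) (d i)
    linarith [hK i (by omega)]

theorem norm_sub_le_mul_norm_logIter_sub {d : ℕ → ℂ} {K r : ℝ} {p : ℕ}
    (hK : ∀ i < p, Real.pi + ‖d i‖ ≤ K) {z w : ℂ} (hz : ‖z‖ ≤ r) (hw : ‖w‖ ≤ r)
    (hz1 : ∀ l < p, 1 ≤ ‖logIter d l z‖) (hw1 : ∀ l < p, 1 ≤ ‖logIter d l w‖) {i : ℕ}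
    (hi : i ≤ p) :
    ‖z - w‖ ≤ (∏ j ∈ Finset.range i, (shiftedLog K)^[j] r) *
      ‖logIter d i z - logIter d i w‖ := by
  induction i with
  | zero => simp [logIter]
  | succ i ih =>
    have h1 := ih (by omega)
    have hz2 := hz1 i (by omega)
    have hw2 := hw1 i (by omega)
    have h2 := norm_sub_le_mul_norm_log_sub
      (norm_pos_iff.1 (zero_lt_one.trans_le hz2)) (norm_pos_iff.1 (zero_lt_one.trans_le hw2))
      (norm_logIter_le hK hz hz1 (show i ≤ p by omega))
      (norm_logIter_le hK hw hw1 (show i ≤ p by omega))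
    have hP : 0 ≤ ∏ j ∈ Finset.range i, (shiftedLog K)^[j] r := Finset.prod_nonneg fun j hj =>
      (norm_nonneg _).trans
        (norm_logIter_le hK hz hz1 (show j ≤ p by have := Finset.mem_range.1 hj; omega))
    rw [Finset.prod_range_succ, mul_assoc, logIter, logIter, add_sub_add_right_eq_sub]
    exact h1.trans (mul_le_mul_of_nonneg_left h2 hP)

/-- The first logarithm contracts by 1/2 on Im z ≥ 2; the later ones act on Re z ≥ 1 and do not
expand. -/
theorem norm_logIter_sub_le {d : ℕ → ℂ} {p : ℕ} {z w : ℂ} (hz : 2 ≤ z.im) (hw : 2 ≤ w.im)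
    (hz1 : ∀ l ≤ p, 1 ≤ l → 1 ≤ (logIter d l z).re) (hw1 : ∀ l ≤ p, 1 ≤ l → 1 ≤ (logIter d l w).re)
    {i : ℕ} (hi : i < p) : ‖logIter d (i + 1) z - logIter d (i + 1) w‖ ≤ 2⁻¹ * ‖z - w‖ := by
  induction i with
  | zero =>
    simp only [logIter, add_sub_add_right_eq_sub]
    refine norm_log_sub_le (convex_halfSpace_im_ge 2) (fun u hu => Or.inr ?_) two_pos
      (fun u hu => ?_) hz hw
    · have : (2 : ℝ) ≤ u.im := hu
      linarith
    · exact (show (2 : ℝ) ≤ u.im from hu).trans ((le_abs_self _).trans (Complex.abs_im_le_norm u))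
  | succ i ih =>
    refine le_trans ?_ (ih (by omega))
    change ‖Complex.log (logIter d (i + 1) z) + d (i + 1) -
      (Complex.log (logIter d (i + 1) w) + d (i + 1))‖ ≤ _
    rw [add_sub_add_right_eq_sub]
    have := norm_log_sub_le (convex_halfSpace_re_ge 1)
      (fun u (hu : (1 : ℝ) ≤ u.re) => Or.inl (zero_lt_one.trans_le hu)) one_pos
      (fun u hu => (show (1 : ℝ) ≤ u.re from hu).trans (Complex.re_le_norm u))
      (hz1 (i + 1) (by omega) (by omega)) (hw1 (i + 1) (by omega) (by omega))
    simpa using this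

/-! ### The Cantor set of bounded itineraries -/

theorem expMap_iterate_add_int {lam : ℂ} {p : ℕ} (hp : 1 ≤ p) (z : ℂ) (s : ℤ) :
    (expMap lam)^[p] (z + 2 * Real.pi * Complex.I * s) = (expMap lam)^[p] z := by
  obtain ⟨r, rfl⟩ : ∃ r, p = r + 1 := ⟨p - 1, by omega⟩
  rw [iterate_succ_apply, iterate_succ_apply, expMap_add_int]

theorem re_add_int (z : ℂ) (s : ℤ) : (z + 2 * Real.pi * Complex.I * s).re = z.re := by
  simp

theorem im_add_int (z : ℂ) (s : ℤ) :
    (z + 2 * Real.pi * Complex.I * s).im = z.im + 2 * Real.pi * s := by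
  simp

/-- The Cantor repeller of a finite system of inverse branches of the `p`-th iterate, together
with its coding map. -/
theorem exists_cantor_coding {lam : ℂ} {p : ℕ} (hp : 1 ≤ p) {d : ℕ → ℂ}
    (hd : ∀ i, lam * Complex.exp (d i) = 1) (M b : ℝ) (N₀ : ℕ) :
    ∃ (N m : ℕ) (κ : C(ℕ → Fin m, ℂ)), N₀ ≤ N ∧ 2 ≤ m ∧ Injective κ ∧
      (∀ ω, M < (κ ω).im ∧ b < (κ ω).re) ∧
      (∀ ω, κ ω = logIter d p (κ fun n => ω (n + 1)) +
        2 * Real.pi * Complex.I * ((N + ω 0 : ℕ) : ℤ)) ∧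
      (∀ ω, ∀ l ≤ p, 1 ≤ ‖logIter d l (κ ω)‖) ∧ (∀ ω, 2 ≤ ‖κ ω‖) ∧ 1 < dimH (range κ) := by
  set K : ℝ := Real.pi + ∑ i ∈ Finset.range p, ‖d i‖ with hKdef
  have hKi : ∀ i < p, Real.pi + ‖d i‖ ≤ K := fun i hi =>
    add_le_add le_rfl (Finset.single_le_sum (f := fun i => ‖d i‖) (fun _ _ => norm_nonneg _)
      (Finset.mem_range.2 hi))
  have hK1 : 1 ≤ K := by
    have : 0 ≤ ∑ i ∈ Finset.range p, ‖d i‖ := Finset.sum_nonneg fun _ _ => norm_nonneg _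
    linarith [Real.pi_gt_three]
  set R : ℝ := max (b + 1) 1
  have hR1 : 1 ≤ R := le_max_right _ _
  have hRb : b + 1 ≤ R := le_max_left _ _
  obtain ⟨M₁, hM₁⟩ := exists_le_norm_logIter (-Real.log ‖lam‖) p R
  set M' : ℝ := max (max (M + 1) M₁) 2
  have hM'2 : 2 ≤ M' := le_max_right _ _
  have hM'M : M + 1 ≤ M' := (le_max_left _ _).trans (le_max_left _ _)
  have hM'1 : M₁ ≤ M' := (le_max_right _ _).trans (le_max_left _ _)
  obtain ⟨N, m, hN, hN1, hNm, hsum⟩ :=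
    exists_shiftedLog_sum hK1 hp (max N₀ ⌈R + M' + K⌉₊)
  have hNbig : R + M' + K ≤ N := (Nat.le_ceil _).trans
    (by exact_mod_cast (le_max_right _ _).trans hN)
  have hN1' : (1 : ℝ) ≤ N := by exact_mod_cast hN1
  have hm0 : (0 : ℝ) ≤ m := m.cast_nonneg
  set ρ : ℝ := 8 * (N + m)
  set S : Set ℂ := {z | R ≤ z.re ∧ M' ≤ z.im ∧ ‖z‖ ≤ ρ} with hS
  have hSclosed : IsClosed S :=
    (isClosed_le continuous_const Complex.continuous_re).inter
      ((isClosed_le continuous_const Complex.continuous_im).inter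
        (isClosed_le continuous_norm continuous_const))
  have hSre : ∀ z ∈ S, ∀ l ≤ p, R ≤ ‖logIter d l z‖ ∧ (1 ≤ l → R ≤ (logIter d l z).re) := by
    intro z hz
    refine hM₁ d (fun i => re_eq_of_mul_exp_eq_one (hd i)) z ?_
    exact hM'1.trans (hz.2.1.trans ((le_abs_self _).trans (Complex.abs_im_le_norm z)))
  have hS1 : ∀ z ∈ S, ∀ l ≤ p, 1 ≤ ‖logIter d l z‖ := fun z hz l hl =>
    hR1.trans (hSre z hz l hl).1
  have hSre1 : ∀ z ∈ S, ∀ l ≤ p, 1 ≤ l → 1 ≤ (logIter d l z).re := fun z hz l hl h =>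
    hR1.trans ((hSre z hz l hl).2 h)
  have hS2 : ∀ z ∈ S, 2 ≤ ‖z‖ := fun z hz =>
    hM'2.trans (hz.2.1.trans ((le_abs_self _).trans (Complex.abs_im_le_norm z)))
  have hiter : ∀ z ∈ S, (expMap lam)^[p] (logIter d p z) = z := by
    intro z hz
    have := expMap_iterate_logIter hd (z := z) (i := 0) (n := p) (fun l hl =>
      norm_pos_iff.1 (zero_lt_one.trans_le (hS1 z hz l (by omega))))
    rwa [zero_add] at this
  obtain ⟨r, hr⟩ : ∃ r, p = r + 1 := ⟨p - 1, by omega⟩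
  have him : ∀ z : ℂ, |(logIter d p z).im| ≤ K := by
    intro z
    rw [hr, logIter, Complex.add_im, Complex.log_im]
    refine (abs_add_le _ _).trans (le_trans ?_ (hKi r (by omega)))
    exact add_le_add (Complex.abs_arg_le_pi _) (Complex.abs_im_le_norm _)
  have hnorm : ∀ z ∈ S, ∀ i : ℕ, ‖logIter d p z + 2 * Real.pi * Complex.I * ((N + i : ℕ) : ℤ)‖ ≤
      8 * (N + i) := by
    intro z hz i
    have h1 := (norm_logIter_le hKi hz.2.2 (fun l hl => hS1 z hz l hl.le) le_rfl).trans hNm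
    have h2 : ‖(2 * Real.pi * Complex.I * ((N + i : ℕ) : ℤ) : ℂ)‖ = 2 * Real.pi * (N + i) := by
      rw [norm_mul, Complex.norm_intCast]
      simp only [norm_mul, Complex.norm_I, Complex.norm_real, Complex.norm_ofNat,
        Real.norm_eq_abs, abs_of_pos Real.pi_pos, mul_one]
      push_cast
      rw [abs_of_nonneg (by positivity)]
    have h3 := norm_add_le (logIter d p z) (2 * Real.pi * Complex.I * ((N + i : ℕ) : ℤ))
    rw [h2] at h3
    have h4 : (0 : ℝ) ≤ i := i.cast_nonneg
    -- The factor 8 originates here: N + 2π(N + i) ≤ 8(N + i), since 2π + 1 < 8.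
    nlinarith [Real.pi_lt_d2]
  have hmaps : ∀ z ∈ S, ∀ i : Fin m,
      logIter d p z + 2 * Real.pi * Complex.I * ((N + i : ℕ) : ℤ) ∈ S := by
    intro z hz i
    have hi : (i : ℝ) ≤ m := by exact_mod_cast i.2.le
    have hi0 : (0 : ℝ) ≤ (i : ℕ) := Nat.cast_nonneg _
    refine ⟨?_, ?_, ?_⟩
    · rw [re_add_int]
      exact (hSre z hz p le_rfl).2 hp
    · rw [im_add_int]
      have := (abs_le.1 (him z)).1
      push_cast
      nlinarith [Real.pi_gt_three]
    · exact (hnorm z hz i).trans (mul_le_mul_of_nonneg_left (by linarith) (by norm_num))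
  have : CompleteSpace S := hSclosed.isComplete.completeSpace_coe
  have : Nonempty S := by
    refine ⟨⟨⟨R, M'⟩, le_rfl, le_rfl, ?_⟩⟩
    refine (Complex.norm_le_abs_re_add_abs_im _).trans ?_
    rw [abs_of_pos (by linarith), abs_of_pos (by linarith)]
    linarith
  let F : Fin m → S → S := fun i z => ⟨_, hmaps z z.2 i⟩
  obtain ⟨κ₀, hκ₀⟩ := exists_coding F (fun i x y => by
    simp only [F, Subtype.dist_eq, dist_eq_norm, add_sub_add_right_eq_sub]
    have h2x := hM'2.trans x.2.2.1
    have h2y := hM'2.trans y.2.2.1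
    have := norm_logIter_sub_le h2x h2y (hSre1 x x.2) (hSre1 y y.2) (show r < p by omega)
    rwa [← hr] at this)
  set κ : C(ℕ → Fin m, ℂ) := ⟨fun ω => κ₀ ω, by fun_prop⟩ with hκdef
  have hκS : ∀ ω, κ ω ∈ S := fun ω => (κ₀ ω).2
  have hκ : ∀ ω, κ ω = logIter d p (κ fun n => ω (n + 1)) +
      2 * Real.pi * Complex.I * ((N + ω 0 : ℕ) : ℤ) := fun ω =>
    congrArg Subtype.val (hκ₀ ω)
  have hinj : Injective κ := by
    have hshift : ∀ ω, (expMap lam)^[p] (κ ω) = κ fun n => ω (n + 1) := by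
      intro ω
      rw [hκ ω, expMap_iterate_add_int hp, hiter _ (hκS _)]
    suffices h : ∀ n, ∀ ω ω', κ ω = κ ω' → ω n = ω' n from fun ω ω' h' =>
      funext fun n => h n ω ω' h'
    intro n
    induction n with
    | zero =>
      intro ω ω' h
      have h1 := hshift ω
      rw [h, hshift ω'] at h1
      have h2 := congrArg Complex.im (hκ ω)
      rw [h, hκ ω', h1, im_add_int, im_add_int] at h2
      have h3 : (((N + ω' 0 : ℕ) : ℤ) : ℝ) = ((N + ω 0 : ℕ) : ℤ) :=
        mul_left_cancel₀ Real.two_pi_pos.ne' (add_left_cancel h2)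
      have h4 : N + (ω' 0 : ℕ) = N + ω 0 := by exact_mod_cast h3
      exact Fin.ext (by omega)
    | succ n ih =>
      intro ω ω' h
      refine ih (fun n => ω (n + 1)) (fun n => ω' (n + 1)) ?_
      rw [← hshift, ← hshift, h]
  set c : ℕ → ℝ := fun i => (∏ j ∈ Finset.range p, (shiftedLog K)^[j] (8 * (N + i)))⁻¹ with hc
  have hL1 : ∀ i j : ℕ, 1 ≤ (shiftedLog K)^[j] (8 * (N + i)) := fun i j =>
    one_le_shiftedLog_iterate hK1 j (by
      have : (0 : ℝ) ≤ i := i.cast_nonneg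
      linarith)
  have hc0 : ∀ i, 0 < c i := fun i =>
    inv_pos.2 (Finset.prod_pos fun j _ => zero_lt_one.trans_le (hL1 i j))
  have hc1 : ∀ i, c i ≤ 1 / 2 := by
    intro i
    rw [hc, one_div]
    refine inv_anti₀ two_pos ?_
    rw [hr, Finset.prod_range_succ']
    have h1 : (1 : ℝ) ≤ ∏ j ∈ Finset.range r, (shiftedLog K)^[j + 1] (8 * (N + i)) :=
      Finset.prod_induction _ (fun x : ℝ => 1 ≤ x) (fun _ _ => one_le_mul_of_one_le_of_one_le)
        le_rfl fun j _ => hL1 i (j + 1)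
    have h2 : (2 : ℝ) ≤ (shiftedLog K)^[0] (8 * (N + i)) := by
      have : (0 : ℝ) ≤ i := i.cast_nonneg
      simp only [iterate_zero, id]
      linarith
    nlinarith
  have hm2 : 2 ≤ m := by
    by_contra! hlt
    have h1 : ∑ i ∈ Finset.range m, c i ≤ ∑ i ∈ Finset.range m, (1 / 2 : ℝ) :=
      Finset.sum_le_sum fun i _ => hc1 i
    rw [Finset.sum_const, Finset.card_range, nsmul_eq_mul] at h1
    have h2 : (m : ℝ) ≤ 1 := by exact_mod_cast (show m ≤ 1 by omega)
    have h3 : 1 < ∑ i ∈ Finset.range m, c i := hsum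
    linarith
  refine ⟨N, m, κ, (le_max_left _ _).trans hN, hm2, hinj, fun ω => ?_, hκ,
    fun ω => hS1 _ (hκS ω), fun ω => hS2 _ (hκS ω), ?_⟩
  · exact ⟨by linarith [(hκS ω).2.1], by linarith [(hκS ω).1]⟩
  set i₀ : Fin m := ⟨0, by omega⟩
  have hcons : Continuous fun ω : ℕ → Fin m => consSeq i₀ ω := by
    refine continuous_pi fun n => ?_
    cases n with
    | zero => exact continuous_const
    | succ n => exact continuous_apply n
  -- The derivative of a branch depends on the point it is applied to, that is, on the next digit.
  -- Applying one extra branch `i₀` shifts the coding so that the ratio `c i` belongs to the first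
  -- digit i.
  set η : C(ℕ → Fin m, ℂ) := κ.comp ⟨_, hcons⟩
  have hη : ∀ (i : Fin m) ω, κ (consSeq i ω) =
      logIter d p (κ ω) + 2 * Real.pi * Complex.I * ((N + i : ℕ) : ℤ) := fun i ω =>
    hκ (consSeq i ω)
  have hηdist : ∀ ω ω', dist (η ω) (η ω') = ‖logIter d p (κ ω) - logIter d p (κ ω')‖ := by
    intro ω ω'
    change dist (κ (consSeq i₀ ω)) (κ (consSeq i₀ ω')) = _
    rw [hη, hη, dist_eq_norm, add_sub_add_right_eq_sub]
  have hηinj : Injective η := by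
    intro ω ω' h
    have h1 : consSeq i₀ ω = consSeq i₀ ω' := hinj h
    funext n
    exact congrFun h1 (n + 1)
  refine (one_lt_dimH_range_coding (c := c) (fun i _ => hc0 i) (fun i _ => hc1 i) hsum η hηinj
    fun i ω ω' => ?_).trans_le (dimH_mono ?_)
  · rw [hηdist, hηdist]
    have h1 := norm_sub_le_mul_norm_logIter_sub (p := p) hKi
      (show ‖κ (consSeq i ω)‖ ≤ 8 * (N + (i : ℕ)) by rw [hη]; exact hnorm _ (hκS _) i)
      (show ‖κ (consSeq i ω')‖ ≤ 8 * (N + (i : ℕ)) by rw [hη]; exact hnorm _ (hκS _) i)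
      (fun l hl => hS1 _ (hκS _) l hl.le) (fun l hl => hS1 _ (hκS _) l hl.le) le_rfl
    have h2 : ‖κ (consSeq i ω) - κ (consSeq i ω')‖ =
        ‖logIter d p (κ ω) - logIter d p (κ ω')‖ := by
      rw [hη, hη, add_sub_add_right_eq_sub]
    rw [← h2, hc]
    exact (inv_mul_le_iff₀ (Finset.prod_pos fun j _ => zero_lt_one.trans_le (hL1 i j))).2 h1
  · rintro _ ⟨ω, rfl⟩
    exact mem_range_self _

/-! ### Expansion, hyperbolic sets and the Julia set -/

theorem deriv_expMap_iterate (lam : ℂ) (n : ℕ) (z : ℂ) :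
    deriv (expMap lam)^[n] z = ∏ j ∈ Finset.range n, (expMap lam)^[j + 1] z := by
  have hd : ∀ w, HasDerivAt (expMap lam) (expMap lam w) w := fun w =>
    (Complex.hasDerivAt_exp w).const_mul lam
  suffices h : HasDerivAt (expMap lam)^[n] (∏ j ∈ Finset.range n, (expMap lam)^[j + 1] z) z from
    h.deriv
  induction n with
  | zero => simpa using hasDerivAt_id z
  | succ n ih =>
    rw [iterate_succ', Finset.prod_range_succ, mul_comm]
    have := (hd ((expMap lam)^[n] z)).comp z ih
    rwa [← iterate_succ_apply' (expMap lam)] at this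

theorem two_pow_le_norm_deriv_iterate {g : ℂ → ℂ} (hg : Differentiable ℂ g) {X : Set ℂ}
    (hX : MapsTo g X X) (h2 : ∀ z ∈ X, 2 ≤ ‖deriv g z‖) (n : ℕ) :
    ∀ z ∈ X, 2 ^ n ≤ ‖deriv g^[n] z‖ := by
  induction n with
  | zero => intro z _; simp
  | succ n ih =>
    intro z hz
    rw [iterate_succ, deriv_comp z ((hg.iterate n) _) (hg z), norm_mul, pow_succ]
    exact mul_le_mul (ih _ (hX hz)) (h2 z hz) (by norm_num) (norm_nonneg _)

/-- Points with bounded orbit along which the derivatives of the iterates of `f^p` blow up belong to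
the Julia set. -/
theorem mem_juliaSet_of_expanding {f : ℂ → ℂ} (hf : Differentiable ℂ f) {p : ℕ} {z : ℂ}
    (hexp : ∀ n : ℕ, 2 ^ n ≤ ‖deriv (f^[p])^[n] z‖) {A : ℝ}
    (hA : ∀ n : ℕ, ‖(f^[p])^[n] z‖ ≤ A) : z ∈ juliaSet f := by
  rintro ⟨U, hU, -, hzU, hnormal⟩
  obtain ⟨φ, hφ, h⟩ := hnormal fun n => p * n
  simp only [iterate_mul] at h
  rcases h with ⟨g, hg⟩ | h
  -- A finite limit would force the derivatives to converge; the limit ∞ is excluded by the bounded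
  -- orbit.
  · have h1 := (hg.deriv (Eventually.of_forall fun n =>
      ((hf.iterate p).iterate (φ n)).differentiableOn) hU).tendsto_at hzU
    have h2 : Tendsto (fun i => ‖(deriv ∘ fun i => (f^[p])^[φ i]) i z‖) atTop atTop := by
      refine tendsto_atTop_mono (fun i => hexp (φ i)) ?_
      exact (tendsto_pow_atTop_atTop_of_one_lt one_lt_two).comp hφ.tendsto_atTop
    exact not_tendsto_nhds_of_tendsto_atTop h2 _ h1.norm
  · obtain ⟨i, hi⟩ := (h {z} (singleton_subset_iff.2 hzU) isCompact_singleton A).exists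
    exact (hi z rfl).not_ge (hA _)

end ExpBasin

end

/-! ### Itineraries, expansion and dimension of the coded set -/

theorem mainTheorem7 (lam : ℂ) (hlam : lam ≠ 0) (p : ℕ) (hp : 1 < p) (z₀ : ℂ)
    (hcycle : ExpBasin.IsAttractingCycle (ExpBasin.expMap lam) p z₀)
    (B C : Set ℂ) (hBC : ExpBasin.IsBasinConstruction (ExpBasin.expMap lam) p z₀ B C)
    (w : ℂ) (hw : w ∉ ExpBasin.domC0 (ExpBasin.expMap lam) p z₀ C)
    (k : ℕ → ℤ)
    (hk : ∀ j : ℕ, 1 ≤ j → j < p →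
      (ExpBasin.expMap lam)^[j] z₀ ∈ ExpBasin.strip (ExpBasin.expMap lam) p z₀ C w (k j)) :
    1 < ExpBasin.hyperbolicDim ((ExpBasin.expMap lam)^[p])
        (ExpBasin.boundedItinerarySet (ExpBasin.expMap lam) p
          (ExpBasin.strip (ExpBasin.expMap lam) p z₀ C w) k) ∧
    ∃ X : Set ℂ,
      X ⊆ ExpBasin.boundedItinerarySet (ExpBasin.expMap lam) p
          (ExpBasin.strip (ExpBasin.expMap lam) p z₀ C w) k ∧
      ExpBasin.IsCantorSet X ∧
      (ExpBasin.expMap lam)^[p] '' X = X ∧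
      (∀ z ∈ X, 1 < ‖deriv ((ExpBasin.expMap lam)^[p]) z‖) ∧
      1 < dimH X := by
  have hp1 : 1 ≤ p := hp.le
  obtain ⟨d, M, b, hd, hk', h0⟩ := ExpBasin.exists_inverse_branches hlam hp hcycle hBC hk
  -- The lower bound on N makes every entry N + `ω n` exceed all |k_j|, so no s_n is one of the k_j.
  obtain ⟨N, m, κ, hN, hm, hinj, hdom, hκ, hone, htwo, hdim⟩ := ExpBasin.exists_cantor_coding
    hp1 hd M b (1 + ∑ j ∈ Finset.range p, (k j).natAbs)
  set f := ExpBasin.expMap lam with hf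
  have hlog : ∀ ω, ∀ j ≤ p, f^[j] (ExpBasin.logIter d p (κ ω)) =
      ExpBasin.logIter d (p - j) (κ ω) := by
    intro ω j hj
    have := ExpBasin.expMap_iterate_logIter hd (z := κ ω) (i := p - j) (n := j) (fun l hl =>
      norm_pos_iff.1 (zero_lt_one.trans_le (hone ω l (by omega))))
    rwa [Nat.sub_add_cancel hj] at this
  have hiter : ∀ ω, ∀ j, 1 ≤ j → j ≤ p →
      f^[j] (κ ω) = ExpBasin.logIter d (p - j) (κ fun n => ω (n + 1)) := by
    intro ω j hj hjp
    rw [hκ ω, ExpBasin.expMap_iterate_add_int hj, hlog _ j hjp]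
  have hshift : ∀ ω, f^[p] (κ ω) = κ fun n => ω (n + 1) := by
    intro ω
    rw [hiter ω p hp1 le_rfl, Nat.sub_self, ExpBasin.logIter]
  have hshiftn : ∀ n ω, (f^[p])^[n] (κ ω) = κ fun l => ω (l + n) := by
    intro n
    induction n with
    | zero => intro ω; rfl
    | succ n ih =>
      intro ω
      rw [Function.iterate_succ_apply, hshift, ih]
      simp only [add_assoc]
  have hinv : f^[p] '' Set.range κ = Set.range κ := by
    apply Set.Subset.antisymm
    · rintro _ ⟨_, ⟨ω, rfl⟩, rfl⟩
      exact ⟨_, (hshift ω).symm⟩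
    · rintro _ ⟨ω, rfl⟩
      exact ⟨_, ⟨ExpBasin.consSeq ⟨0, by omega⟩ ω, rfl⟩, hshift _⟩
  have hderiv : ∀ z ∈ Set.range κ, 2 ≤ ‖deriv f^[p] z‖ := by
    rintro _ ⟨ω, rfl⟩
    obtain ⟨r, hr⟩ : ∃ r, p = r + 1 := ⟨p - 1, by omega⟩
    rw [ExpBasin.deriv_expMap_iterate, norm_prod]
    have h1 : (1 : ℝ) ≤ ∏ j ∈ Finset.range r, ‖f^[j + 1] (κ ω)‖ := by
      have hj : ∀ j ∈ Finset.range r, (1 : ℝ) ≤ ‖f^[j + 1] (κ ω)‖ := fun j hj => by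
        have := Finset.mem_range.1 hj
        rw [hiter ω (j + 1) (by omega) (by omega)]
        exact hone _ _ (by omega)
      exact Finset.prod_induction _ (fun x : ℝ => 1 ≤ x)
        (fun _ _ => one_le_mul_of_one_le_of_one_le) le_rfl hj
    have h2 : 2 ≤ ‖f^[p] (κ ω)‖ := by
      rw [hshift]
      exact htwo _
    rw [hr, Finset.prod_range_succ, ← hf, ← hr]
    nlinarith
  have hfd : Differentiable ℂ f := by
    rw [hf]
    unfold ExpBasin.expMap
    fun_prop
  have hexp := ExpBasin.two_pow_le_norm_deriv_iterate (hfd.iterate p)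
    (Set.mapsTo_iff_image_subset.2 hinv.subset) hderiv
  have hcpt : IsCompact (Set.range κ) := isCompact_range κ.continuous
  obtain ⟨A, hA⟩ := hcpt.isBounded.exists_norm_le
  -- Whole periods shift the word, and the remainder n % p selects the position within the period: 0
  -- gives the free entry, j > 0 the entry k_j.
  have hmod : ∀ n ω, f^[n] (κ ω) = f^[n % p] (κ fun l => ω (l + n / p)) := by
    intro n ω
    rw [← hshiftn, ← Function.iterate_mul, ← Function.iterate_add_apply, Nat.mod_add_div]
  have hsub : Set.range κ ⊆ ExpBasin.boundedItinerarySet f p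
      (ExpBasin.strip f p z₀ C w) k := by
    rintro _ ⟨ω, rfl⟩
    refine ⟨?_, ⟨fun n => if n % p = 0 then ((N + ω (n / p) : ℕ) : ℤ) else k (n % p),
      ⟨fun n j hj hjp => ?_, ?_⟩, fun n => ?_⟩, ?_⟩
    · exact ExpBasin.mem_juliaSet_of_expanding hfd (fun n => hexp n _ ⟨ω, rfl⟩)
        (A := A) (fun n => hA _ (by rw [hshiftn]; exact Set.mem_range_self _))
    · have : (n * p + j) % p = j := by
        rw [Nat.mul_add_mod_self_right, Nat.mod_eq_of_lt hjp]
      simp only [this]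
      rw [if_neg (by omega)]
    · convert! Set.infinite_univ (α := ℕ)
      refine Set.eq_univ_of_forall fun n j hj hjp => ?_
      simp only [Nat.mul_mod_left, if_true]
      have := Finset.single_le_sum (f := fun j => (k j).natAbs) (fun _ _ => Nat.zero_le _)
        (Finset.mem_range.2 hjp)
      omega
    · rw [hmod]
      by_cases hn : n % p = 0
      · simp only [hn, if_true, Function.iterate_zero, id]
        rw [hκ]
        have := h0 _ (hdom fun l => ω (l + 1 + n / p)).1 (hdom _).2 ((N + ω (n / p) : ℕ) : ℤ)
        simpa only [zero_add] using this
      · simp only [hn, if_false]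
        have hlt := Nat.mod_lt n hp1
        rw [hiter _ _ (by omega) hlt.le]
        exact hk' _ (hdom _).1 _ (by omega) hlt
    · have hK : IsCompact (⋃ j ∈ Finset.range p, f^[j] '' Set.range κ) :=
        (Finset.range p).isCompact_biUnion fun j _ => hcpt.image (hfd.continuous.iterate j)
      refine hK.isBounded.subset ?_
      rintro _ ⟨n, rfl⟩
      simp only [hmod n]
      exact Set.mem_biUnion (Finset.mem_range.2 (Nat.mod_lt n hp1)) ⟨_, ⟨_, rfl⟩, rfl⟩
  refine ⟨hdim.trans_le ?_, Set.range κ, hsub, ExpBasin.isCantorSet_range hm κ hinj, hinv,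
    fun z hz => one_lt_two.trans_le (hderiv z hz), hdim⟩
  refine le_iSup₂_of_le (Set.range κ) hsub (le_iSup_of_le ⟨hcpt, hinv, ?_⟩ le_rfl)
  exact ⟨1, one_pos, 2, one_lt_two, fun n z hz => by rw [one_mul]; exact hexp n z hz⟩
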